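/- **Theorem 1.1.** Let $T>0$, $a,b>0$, $p>1$, $\alpha\in(1/p,1]$ and $f\in C^1([0,T]\times\mathbb R,\mathbb R)$; put $F(t,x)=\int_0^x f(t,s)\,ds$ and $\phi_p(s)=|s|^{p-2}s$ for $s\neq0$, $\phi_p(0)=0$. Let ${}_0D_t^\alpha$ and ${}_tD_T^\alpha$ be the left and right Riemann–Liouville fractional derivatives of order $\alpha$. Thus ${}_0D_t^\alpha u=\frac{d}{dt}\,{}_0I_t^{1-\alpha}u$ for $\alpha<1$, where ${}_0I_t^{\gamma}u(t)=\frac1{\Gamma(\gamma)}\int_0^t(t-s)^{\gamma-1}u(s)\,ds$, and ${}_0D_t^1u=u'$. Assume: * (H1) for every $t\in[0,T]$ the map $x\mapsto f(t,x)/|x|^{p^2-1}$ is strictly increasing on $\mathbb R\setminus\{0\}$; * (H2) $f(t,x)=o(|x|^{p-1})$ as $|x|\to0$, uniformly in $t\in[0,T]$; * (H3) there are constants $\mu>p^2$ and $R>0$ such that $0<\mu F(t,x)\le x f(t,x)$ for all $t\in[0,T]$ and all $x\in\mathbb R$ with $|x|\ge R$. Let $E_0^{\alpha,p}$ be the closure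 of the smooth functions with compact support in $(0,T)$ with respect to the norm $(\|u\|_{L^p}^p+\|{}_0D_t^\alpha u\|_{L^p}^p)^{1/p}$, where $L^p=L^p(0,T)$. For $u,v\in E_0^{\alpha,p}$ put $$I(u)=\frac1{bp^2}\Big(a+b\int_0^T|{}_0D_t^\alpha u|^p\,dt\Big)^p-\int_0^TF(t,u(t))\,dt-\frac{a^p}{bp^2},$$ $$\langle I'(u),v\rangle=\Big(a+b\int_0^T|{}_0D_t^\alpha u|^p\,dt\Big)^{p-1}\int_0^T\phi_p({}_0D_t^\alpha u)\,{}_0D_t^\alpha v\,dt-\int_0^Tf(t,u(t))v(t)\,dt,$$ and let $\mathcal N=\{u\in E_0^{\alpha,p}\setminus\{0\}:\langle I'(u),u\rangle=0\}$ be the Nehari manifold. A weak solution of the Dirichlet problem $$\Big(a+b\int_0^T|{}_0D_t^\alpha u|^p\,dt\Big)^{p-1}{}_tD_T^\alpha\phi_p({}_0D_t^\alpha u)=f(t,u)\ \text{ in }(0,T),\qquad u(0)=u(T)=0,$$ is a function $u\in E_0^{\alpha,p}$, continuous on $[0,T]$, with $u(0)=u(T)=0$ and $\langle I'(u),v\rangle=0$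 for all $v\in E_0^{\alpha,p}$. A nontrivial ground state solution is a nonzero weak solution whose energy $I$ is least among all nonzero weak solutions. Then the Dirichlet problem has a nontrivial ground state solution $u^*$; moreover $u^*$ can be chosen with $u^*\in\mathcal N$ and $I(u^*)=\min_{\mathcal N}I$. -/

import Mathlib

open MeasureTheory Set
open scoped ContDiff ENNReal

noncomputable section

namespace FracKirchhoff

/-- The left Riemann–Liouville fractional integral `₀I_t^γ u (t)` of order `γ > 0`, based at `0`. -/
def rlIntegral (γ : ℝ) (u : ℝ → ℝ) (t : ℝ) : ℝ :=
  1 / Real.Gamma γ * ∫ s in (0 : ℝ)..t, (t - s) ^ (γ - 1) * u s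

/-- The left Riemann–Liouville fractional derivative `₀D_t^γ u (t)` of order `γ ≥ 0`:
`dⁿ/dtⁿ ₀I_t^{n-γ} u` for the natural number `n` with `n - 1 ≤ γ < n`. -/
def rlDeriv (γ : ℝ) (u : ℝ → ℝ) (t : ℝ) : ℝ :=
  iteratedDeriv (⌊γ⌋₊ + 1) (rlIntegral ((⌊γ⌋₊ + 1 : ℕ) - γ) u) t

/-- The map `φ_p(s) = |s|^{p-2} s` for `s ≠ 0`, and `φ_p(0) = 0`. -/
def phi (p s : ℝ) : ℝ := if s = 0 then 0 else |s| ^ (p - 2) * s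

/-- Lebesgue measure on the interval of length `T` starting at `0` (endpoints are negligible). -/
def vol (T : ℝ) : Measure ℝ := volume.restrict (Ioc 0 T)

/-- Smooth functions with compact support in `(0, T)`. -/
def IsTest (T : ℝ) (φ : ℝ → ℝ) : Prop :=
  ContDiff ℝ ∞ φ ∧ HasCompactSupport φ ∧ tsupport φ ⊆ Ioo 0 T

/-- The distance of `u` and `w` in the norm
`(‖u‖_{L^p}^p + ‖₀D_t^α u‖_{L^p}^p)^{1/p}`. The derivatives are subtracted after they are taken,
so the distance is never the derivative of a non-differentiable difference. -/
def energyDist (T α p : ℝ) (u w : ℝ → ℝ) : ℝ≥0∞ :=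
  (eLpNorm (fun t => u t - w t) (ENNReal.ofReal p) (vol T) ^ p
    + eLpNorm (fun t => rlDeriv α u t - rlDeriv α w t) (ENNReal.ofReal p) (vol T) ^ p) ^ (1 / p)

/-- The fractional derivative space `E₀^{α,p}` (for `1/p < α ≤ 1`): the functions `u` on `(0, T)`
with `u, ₀D_t^α u ∈ L^p` that lie in the closure of the test functions. Membership depends only
on the a.e. class of `u` on `(0, T)`. If test functions `φₙ` tend to `u` in this sense then
`u = ₀I_t^α (₀D_t^α u)` a.e., so `₀I_t^{1-α} u` is absolutely continuous, and `₀D_t^α u` is a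
genuine derivative a.e. -/
def E0 (T α p : ℝ) : Set (ℝ → ℝ) :=
  {u | MemLp u (ENNReal.ofReal p) (vol T) ∧ MemLp (rlDeriv α u) (ENNReal.ofReal p) (vol T) ∧
    ∀ ε : ℝ≥0∞, 0 < ε → ∃ φ, IsTest T φ ∧ energyDist T α p u φ < ε}

/-- `u` is a nonzero element of the function space. -/
def Nontriv (T : ℝ) (u : ℝ → ℝ) : Prop := ¬ (u =ᵐ[vol T] fun _ => 0)

/-- `∫₀ᵀ |₀D_t^α u|^p dt`. -/
def dEnergy (T α p : ℝ) (u : ℝ → ℝ) : ℝ := ∫ t in (0 : ℝ)..T, |rlDeriv α u t| ^ p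

/-- The primitive `F(t,x) = ∫₀ˣ f(t,s) ds`. -/
def primitive (f : ℝ → ℝ → ℝ) (t x : ℝ) : ℝ := ∫ s in (0 : ℝ)..x, f t s

/-- The energy functional `I`. -/
def energy (T α p a b : ℝ) (f : ℝ → ℝ → ℝ) (u : ℝ → ℝ) : ℝ :=
  1 / (b * p ^ 2) * (a + b * dEnergy T α p u) ^ p
    - (∫ t in (0 : ℝ)..T, primitive f t (u t)) - a ^ p / (b * p ^ 2)

/-- The first variation `⟨I'(u), v⟩`. -/
def firstVariation (T α p a b : ℝ) (f : ℝ → ℝ → ℝ) (u v : ℝ → ℝ) : ℝ :=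
  (a + b * dEnergy T α p u) ^ (p - 1)
      * (∫ t in (0 : ℝ)..T, phi p (rlDeriv α u t) * rlDeriv α v t)
    - ∫ t in (0 : ℝ)..T, f t (u t) * v t

/-- The Nehari manifold `{u ∈ E₀^{α,p} ∖ {0} : ⟨I'(u), u⟩ = 0}`. -/
def nehari (T α p a b : ℝ) (f : ℝ → ℝ → ℝ) : Set (ℝ → ℝ) :=
  {u | u ∈ E0 T α p ∧ Nontriv T u ∧ firstVariation T α p a b f u u = 0}

/-- Weak solutions of
`(a + b ∫₀ᵀ |₀D_t^α u|^p)^{p-1} ₜD_T^α φ_p(₀D_t^α u) = f(t,u)` on `(0,T)`, `u(0) = u(T) = 0`: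
continuous functions in `E₀^{α,p}` with these boundary values that satisfy the equation tested
with every `v ∈ E₀^{α,p}`, where the right derivative `ₜD_T^α` is moved onto `v` as `₀D_t^α`. -/
def IsWeakSolution (T α p a b : ℝ) (f : ℝ → ℝ → ℝ) (u : ℝ → ℝ) : Prop :=
  u ∈ E0 T α p ∧ ContinuousOn u (Icc 0 T) ∧ u 0 = 0 ∧ u T = 0 ∧
    ∀ v ∈ E0 T α p,
      (a + b * dEnergy T α p u) ^ (p - 1)
          * (∫ t in (0 : ℝ)..T, phi p (rlDeriv α u t) * rlDeriv α v t)
        = ∫ t in (0 : ℝ)..T, f t (u t) * v t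

/-- Nontrivial ground state solutions: nontrivial weak solutions of least energy among all
nontrivial weak solutions. -/
def IsGroundState (T α p a b : ℝ) (f : ℝ → ℝ → ℝ) (u : ℝ → ℝ) : Prop :=
  IsWeakSolution T α p a b f u ∧ Nontriv T u ∧
    ∀ w, IsWeakSolution T α p a b f w → Nontriv T w →
      energy T α p a b f u ≤ energy T α p a b f w

end FracKirchhoff

end

open Filter Topology

/-! Take the fractional derivative $g = {}_0D_t^\alpha u$ as the unknown. Then $u = I^\alpha g$
a.e., and `mem_E0_iff` identifies $E_0^{\alpha,p}$ with a closed subspace `derivSpace` of $L^p$, the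
closure of the derivatives of test functions. In this variable the Kirchhoff term depends only on
$\|g\|$, and the nonlinear term only on $Kg = I^\alpha g$. Because $\alpha > 1/p$, Hölder's
inequality against the kernel gives $Kg$ a modulus of continuity of order $\alpha - 1/p$, so $K$ is
compact into $C[0,T]$ by Arzelà–Ascoli. What remains is an abstract problem, recorded in
`KirchhoffData`.

On a ray $s \mapsto sg$, divide the derivative of the energy by $s^{p^2-1}$. The Kirchhoff part is
strictly decreasing because $a > 0$, and the nonlinear part is nondecreasing by (H1), so a Nehari
point maximises the energy on its ray (`E_smul_le`). By (H2) the derivative is positive near the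
origin and by (H3) it is negative far out, so every ray meets the Nehari manifold. Subtracting
$p^{-2}\langle I'(g), g\rangle$ from the energy shows that it is nonnegative and coercive there
(`le_E_of_mem_N`).

For a minimising sequence $g_n$, compactness gives $Kg_n \to u$ and $\|g_n\| \to L$ along a
subsequence. Uniform convexity of $L^p$ replaces weak compactness: it yields $g_0$ with $Kg_0 = u$
and $\|g_0\| \le L$. This $g_0$ need not lie on the manifold, but some multiple $tg_0$ does, and
$E(tg_0) \le \lim E(tg_n) \le \lim E(g_n)$, which is the infimum.

The minimiser is critical by a deformation argument that needs no manifold structure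
(`dE_eq_zero_of_isMinOn_N`): a descent direction $k$ would give a Nehari point $sg + ek$ with energy
below $E(sg) \le E(g)$. Every nontrivial weak solution, tested with itself, lies on the Nehari
manifold, so the minimiser is a ground state. -/

/-! ### Convexity of $|x|^p$ and uniform convexity of $L^p$. -/

theorem abs_midpoint_rpow_le {p : ℝ} (hp : 1 < p) (a b : ℝ) :
    |(a + b) / 2| ^ p ≤ (|a| ^ p + |b| ^ p) / 2 := by
  have h1 : |(a + b) / 2| ≤ (1 / 2 : ℝ) • |a| + (1 / 2 : ℝ) • |b| := by
    rw [abs_div, abs_two, smul_eq_mul, smul_eq_mul]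
    linarith [abs_add_le a b]
  have h2 := (convexOn_rpow hp.le).2 (abs_nonneg a) (abs_nonneg b)
    (by norm_num : (0 : ℝ) ≤ 1 / 2) (by norm_num : (0 : ℝ) ≤ 1 / 2) (by norm_num)
  have h3 := Real.rpow_le_rpow (abs_nonneg _) h1 (by linarith : 0 ≤ p)
  simp only [smul_eq_mul] at h2 h3
  linarith

theorem abs_midpoint_rpow_lt {p : ℝ} (hp : 1 < p) {a b : ℝ} (hab : a ≠ b) :
    |(a + b) / 2| ^ p < (|a| ^ p + |b| ^ p) / 2 := by
  by_cases h : |a| = |b|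
  · rcases abs_eq_abs.1 h with h | h
    · exact absurd h hab
    · have hb : b ≠ 0 := by
        rintro rfl
        simp [h] at hab
      have : 0 < |b| ^ p := Real.rpow_pos_of_pos (abs_pos.2 hb) p
      subst h
      simp only [neg_add_cancel, zero_div, abs_zero, abs_neg]
      rw [Real.zero_rpow (by linarith)]
      linarith
  · have h1 : |(a + b) / 2| ≤ (1 / 2 : ℝ) • |a| + (1 / 2 : ℝ) • |b| := by
      rw [abs_div, abs_two, smul_eq_mul, smul_eq_mul]
      linarith [abs_add_le a b]
    have h2 := (strictConvexOn_rpow hp).2 (abs_nonneg a) (abs_nonneg b) h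
      (by norm_num : (0 : ℝ) < 1 / 2) (by norm_num : (0 : ℝ) < 1 / 2) (by norm_num)
    have h3 := Real.rpow_le_rpow (abs_nonneg _) h1 (by linarith : 0 ≤ p)
    simp only [smul_eq_mul] at h2 h3
    linarith

/-- A quantitative form of the strict convexity of `|x| ^ p`. -/
theorem exists_abs_sub_rpow_le {p ε : ℝ} (hp : 1 < p) (hε : 0 < ε) :
    ∃ C : ℝ, 0 < C ∧ ∀ a b : ℝ, |a - b| ^ p ≤
      ε * (|a| ^ p + |b| ^ p) + C * ((|a| ^ p + |b| ^ p) / 2 - |(a + b) / 2| ^ p) := by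
  have hp0 : 0 < p := by linarith
  have hc : ∀ g : ℝ × ℝ → ℝ, Continuous g → Continuous fun z => |g z| ^ p := fun g hg =>
    hg.abs.rpow_const fun _ => Or.inr hp0.le
  have c1 := hc (fun z => z.1) continuous_fst
  have c2 := hc (fun z => z.2) continuous_snd
  have c3 := hc (fun z => z.1 - z.2) (by fun_prop)
  have c4 := hc (fun z => (z.1 + z.2) / 2) (by fun_prop)
  let S : Set (ℝ × ℝ) := {z | |z.1| ^ p + |z.2| ^ p = 1 ∧ ε ≤ |z.1 - z.2| ^ p}
  have hScl : IsClosed S :=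
    (isClosed_eq (c1.add c2) continuous_const).inter (isClosed_le continuous_const c3)
  have le_one : ∀ x : ℝ, |x| ^ p ≤ 1 → |x| ≤ 1 := fun x hx => by
    by_contra! h
    exact absurd hx (not_le.2 (Real.one_lt_rpow h hp0))
  have nn : ∀ x : ℝ, 0 ≤ |x| ^ p := fun x => Real.rpow_nonneg (abs_nonneg x) p
  have hSc : IsCompact S := by
    refine (isCompact_Icc.prod isCompact_Icc).of_isClosed_subset hScl
      (t := S) (s := Icc (-1 : ℝ) 1 ×ˢ Icc (-1 : ℝ) 1) ?_
    rintro ⟨a, b⟩ ⟨h, -⟩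
    exact ⟨abs_le.1 (le_one a (by linarith [nn b])), abs_le.1 (le_one b (by linarith [nn a]))⟩
  -- On `S` the midpoint gap is positive, since $\varepsilon > 0$ forces $a \ne b$. The quotient is
  -- therefore continuous, and bounded by compactness.
  obtain ⟨C, hC, hCS⟩ : ∃ C : ℝ, 0 < C ∧ ∀ z ∈ S,
      |z.1 - z.2| ^ p ≤ C * ((|z.1| ^ p + |z.2| ^ p) / 2 - |(z.1 + z.2) / 2| ^ p) := by
    have hpos : ∀ z ∈ S, 0 < (|z.1| ^ p + |z.2| ^ p) / 2 - |(z.1 + z.2) / 2| ^ p := by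
      rintro ⟨a, b⟩ ⟨-, h⟩
      refine sub_pos.2 (abs_midpoint_rpow_lt hp fun hab => ?_)
      rw [hab, sub_self, abs_zero, Real.zero_rpow hp0.ne'] at h
      linarith
    obtain ⟨M, hM⟩ := hSc.exists_bound_of_continuousOn (f := fun z : ℝ × ℝ =>
      |z.1 - z.2| ^ p / ((|z.1| ^ p + |z.2| ^ p) / 2 - |(z.1 + z.2) / 2| ^ p))
      (ContinuousOn.div c3.continuousOn (((c1.add c2).div_const 2).sub c4).continuousOn
        fun z hz => (hpos z hz).ne')
    refine ⟨max M 1, by positivity, fun z hz => ?_⟩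
    have := (le_abs_self _).trans ((hM z hz).trans (le_max_left M 1))
    rwa [div_le_iff₀ (hpos z hz)] at this
  refine ⟨C, hC, fun a b => ?_⟩
  have key : ∀ a b : ℝ, |a| ^ p + |b| ^ p = 1 → |a - b| ^ p ≤
      ε * (|a| ^ p + |b| ^ p) + C * ((|a| ^ p + |b| ^ p) / 2 - |(a + b) / 2| ^ p) := by
    intro a b h
    have h0 : 0 ≤ C * ((|a| ^ p + |b| ^ p) / 2 - |(a + b) / 2| ^ p) :=
      mul_nonneg hC.le (sub_nonneg.2 (abs_midpoint_rpow_le hp a b))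
    by_cases hS : ε ≤ |a - b| ^ p
    · have := hCS (a, b) ⟨h, hS⟩
      simp only at this
      rw [h] at this ⊢
      linarith
    · rw [h] at h0 ⊢
      linarith [not_le.1 hS]
  rcases (add_nonneg (nn a) (nn b)).eq_or_lt with h0 | h0
  · have ha : |a| ^ p = 0 := by linarith [nn a, nn b]
    have hb : |b| ^ p = 0 := by linarith [nn a, nn b]
    rw [Real.rpow_eq_zero (abs_nonneg _) hp0.ne', abs_eq_zero] at ha hb
    simp [ha, hb, Real.zero_rpow hp0.ne']
  -- All terms are homogeneous of degree $p$, so division by $t = s^{1/p}$ reduces to the normalised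
  -- case.
  · set s := |a| ^ p + |b| ^ p with hs
    set t := s ^ (1 / p) with ht
    have htp : t ^ p = s := by
      rw [ht, ← Real.rpow_mul h0.le, one_div_mul_cancel hp0.ne', Real.rpow_one]
    have ht0 : 0 < t := Real.rpow_pos_of_pos h0 _
    have sc : ∀ x : ℝ, |x / t| ^ p = |x| ^ p / s := fun x => by
      rw [abs_div, abs_of_pos ht0, Real.div_rpow (abs_nonneg _) ht0.le, htp]
    have := key (a / t) (b / t) (by rw [sc, sc, ← add_div, ← hs, div_self h0.ne'])
    rw [← sub_div, ← add_div, div_right_comm (a + b), sc, sc, sc, sc, ← add_div, ← hs,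
      div_self h0.ne', div_le_iff₀ h0] at this
    refine this.trans_eq ?_
    field_simp

section LpNorm

variable {Ω : Type*} [MeasurableSpace Ω] {μ : Measure Ω} {p : ℝ}

theorem MeasureTheory.Lp.norm_rpow_eq_integral (hp : 0 < p) (g : Lp ℝ (ENNReal.ofReal p) μ) :
    ‖g‖ ^ p = ∫ t, |g t| ^ p ∂μ := by
  have h := (Lp.memLp g).eLpNorm_eq_integral_rpow_norm (by simpa using hp) ENNReal.ofReal_ne_top
  rw [ENNReal.toReal_ofReal hp.le] at h
  have hnn : 0 ≤ ∫ t, ‖g t‖ ^ p ∂μ :=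
    integral_nonneg fun t => Real.rpow_nonneg (norm_nonneg _) p
  rw [Lp.norm_def, h, ENNReal.toReal_ofReal (Real.rpow_nonneg hnn _), ← Real.rpow_mul hnn,
    inv_mul_cancel₀ hp.ne', Real.rpow_one]
  rfl

theorem MeasureTheory.MemLp.integrable_abs_rpow {g : Ω → ℝ} (hp : 0 < p)
    (hg : MemLp g (ENNReal.ofReal p) μ) : Integrable (fun t => |g t| ^ p) μ := by
  have := hg.integrable_norm_rpow (by simpa using hp) ENNReal.ofReal_ne_top
  rwa [ENNReal.toReal_ofReal hp.le] at this

/-- The spaces `L^p` with `1 < p < ∞` are uniformly convex. -/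
theorem uniformConvexSpace_Lp (hp : 1 < p) [Fact (1 ≤ ENNReal.ofReal p)] :
    UniformConvexSpace (Lp ℝ (ENNReal.ofReal p) μ) := by
  have hp0 : 0 < p := by linarith
  refine ⟨fun ε hε => ?_⟩
  have hεp : 0 < ε ^ p := Real.rpow_pos_of_pos hε p
  obtain ⟨C, hC, hCab⟩ := exists_abs_sub_rpow_le hp (by positivity : 0 < ε ^ p / 4)
  -- Since $\|x\|^p + \|y\|^p = 2$, the constant $\varepsilon^p/4$ absorbs only half of
  -- $\varepsilon^p \le \|x-y\|^p$. The other half forces the $p$-th power of the norm of the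
  -- midpoint to be at most `r`.
  set r : ℝ := 1 - ε ^ p / (2 * C) with hr
  have hr1 : r < 1 := by
    rw [hr]; linarith [show 0 < ε ^ p / (2 * C) by positivity]
  -- `r` may be negative; the maximum keeps the base of the $p$-th root nonnegative.
  have hm1 : max r 0 ^ (1 / p) < 1 :=
    Real.rpow_lt_one (le_max_right _ _) (max_lt hr1 one_pos) (by positivity)
  refine ⟨2 - 2 * max r 0 ^ (1 / p), by linarith, fun x hx y hy hxy => ?_⟩
  have ix := (Lp.memLp x).integrable_abs_rpow hp0
  have iy := (Lp.memLp y).integrable_abs_rpow hp0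
  have iz := (Lp.memLp ((1 / 2 : ℝ) • (x + y))).integrable_abs_rpow hp0
  have id := (Lp.memLp (x - y)).integrable_abs_rpow hp0
  have is : Integrable (fun t => |x t| ^ p + |y t| ^ p) μ := ix.add iy
  have im : Integrable (fun t => (|x t| ^ p + |y t| ^ p) / 2 -
    |((1 / 2 : ℝ) • (x + y) : Lp ℝ (ENNReal.ofReal p) μ) t| ^ p) μ := (is.div_const 2).sub iz
  have hle : ∫ t, |(x - y) t| ^ p ∂μ ≤ ∫ t, (ε ^ p / 4 * (|x t| ^ p + |y t| ^ p) +
      C * ((|x t| ^ p + |y t| ^ p) / 2 - |((1 / 2 : ℝ) • (x + y)) t| ^ p)) ∂μ := by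
    refine integral_mono_ae id ((is.const_mul _).add (im.const_mul _)) ?_
    filter_upwards [Lp.coeFn_sub x y, Lp.coeFn_smul (1 / 2 : ℝ) (x + y), Lp.coeFn_add x y]
      with t h1 h2 h3
    rw [h1, h2, Pi.smul_apply, h3]
    have : (1 / 2 : ℝ) • (x + y : Ω → ℝ) t = (x t + y t) / 2 := by
      simp only [smul_eq_mul, Pi.add_apply]; ring
    rw [this]
    exact hCab (x t) (y t)
  have hsum : ∫ t, (|x t| ^ p + |y t| ^ p) ∂μ = 2 := by
    rw [integral_add ix iy, ← Lp.norm_rpow_eq_integral hp0, ← Lp.norm_rpow_eq_integral hp0,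
      hx, hy, Real.one_rpow]
    norm_num
  rw [integral_add (is.const_mul _) (im.const_mul _),
    integral_const_mul, integral_const_mul, integral_sub (is.div_const 2) iz,
    integral_div, hsum, ← Lp.norm_rpow_eq_integral hp0, ← Lp.norm_rpow_eq_integral hp0] at hle
  have h1 := Real.rpow_le_rpow hε.le hxy hp0.le
  have h2 : ‖(1 / 2 : ℝ) • (x + y)‖ ^ p ≤ r := by
    have : ε ^ p / 2 ≤ C * (1 - ‖(1 / 2 : ℝ) • (x + y)‖ ^ p) := by linarith
    rw [hr, le_sub_comm, div_le_iff₀ (by positivity)]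
    linarith
  have h3 : ‖(1 / 2 : ℝ) • (x + y)‖ ≤ max r 0 ^ (1 / p) := by
    rw [one_div p, Real.le_rpow_inv_iff_of_pos (norm_nonneg _) (le_max_right _ _) hp0]
    exact h2.trans (le_max_left _ _)
  rw [norm_smul, Real.norm_of_nonneg (by norm_num)] at h3
  linarith

end LpNorm

/-! ### A replacement for weak compactness in uniformly convex spaces. -/

section WeakCompactness

variable {X Y : Type*} [NormedAddCommGroup X] [NormedSpace ℝ X]
  [UniformConvexSpace X] [NormedAddCommGroup Y] [NormedSpace ℝ Y]

theorem Submodule.uniformConvexSpace {X : Type*} [NormedAddCommGroup X] [NormedSpace ℝ X]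
    [UniformConvexSpace X] (V : Submodule ℝ X) : UniformConvexSpace V :=
  ⟨fun _ hε => by
    obtain ⟨δ, hδ, h⟩ := exists_forall_sphere_dist_add_le_two_sub X hε
    exact ⟨δ, hδ, fun x hx y hy hxy => h hx hy hxy⟩⟩

/-- In a uniformly convex space, a sequence in the ball of radius `d` is Cauchy if the norms of its
pairwise sums tend to `2 * d`. -/
theorem UniformConvexSpace.cauchySeq_of_norm_add {x : ℕ → X} {d : ℝ}
    (hx : ∀ n, ‖x n‖ ≤ d)
    (hadd : ∀ η > 0, ∃ N, ∀ m ≥ N, ∀ n ≥ N, 2 * d - η < ‖x m + x n‖) : CauchySeq x := by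
  rw [Metric.cauchySeq_iff]
  intro ε hε
  obtain ⟨δ, hδ, h⟩ := exists_forall_closed_ball_dist_add_le_two_mul_sub X hε d
  obtain ⟨N, hN⟩ := hadd δ hδ
  refine ⟨N, fun m hm n hn => ?_⟩
  by_contra! hcon
  rw [dist_eq_norm] at hcon
  exact absurd (h (hx m) (hx n) hcon) (not_le.2 (hN m hm n hn))

/-- A substitute for weak compactness: if `K gₙ → u` and `‖gₙ‖ → L`, then `u = K g` for some `g`
with `‖g‖ ≤ L`. -/
theorem UniformConvexSpace.exists_map_eq_of_tendsto [CompleteSpace X] (K : X →L[ℝ] Y)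
    {g : ℕ → X} {u : Y} {L : ℝ}
    (hu : Tendsto (fun n => K (g n)) atTop (𝓝 u)) (hL : Tendsto (fun n => ‖g n‖) atTop (𝓝 L)) :
    ∃ g₀, K g₀ = u ∧ ‖g₀‖ ≤ L := by
  -- These midpoint-convex sets shrink to the fibre of `K` over `u` and eventually contain the
  -- sequence. Elements of nearly minimal norm in them will converge, and their limit serves as the
  -- weak limit.
  let S : ℕ → Set X := fun n => {h | ‖K h - u‖ ≤ 1 / ((n : ℝ) + 1)}
  have hSanti : ∀ {m n}, m ≤ n → S n ⊆ S m := fun {m n} hmn h hh =>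
    le_trans (show ‖K h - u‖ ≤ 1 / ((n : ℝ) + 1) from hh) (Nat.one_div_le_one_div hmn)
  have hSg : ∀ n, ∀ᶠ k in atTop, g k ∈ S n := fun n => by
    have := (tendsto_iff_norm_sub_tendsto_zero.1 hu).eventually_le_const
      (show (0 : ℝ) < 1 / ((n : ℝ) + 1) by positivity)
    exact this
  have hSmid : ∀ n, ∀ x ∈ S n, ∀ y ∈ S n, (1 / 2 : ℝ) • (x + y) ∈ S n := by
    intro n x hx y hy
    have : K ((1 / 2 : ℝ) • (x + y)) - u = (1 / 2 : ℝ) • ((K x - u) + (K y - u)) := by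
      rw [map_smul, map_add]
      module
    change ‖_‖ ≤ _
    rw [this, norm_smul, Real.norm_of_nonneg (by norm_num)]
    have h1 := norm_add_le (K x - u) (K y - u)
    have h2 : ‖K x - u‖ ≤ _ := hx
    have h3 : ‖K y - u‖ ≤ _ := hy
    linarith
  let d : ℕ → ℝ := fun n => sInf (norm '' S n)
  have hbdd : ∀ n, BddBelow (norm '' S n) := fun n =>
    ⟨0, by rintro _ ⟨x, -, rfl⟩; exact norm_nonneg x⟩
  have hne : ∀ n, (norm '' S n).Nonempty := fun n => (hSg n).exists.elim fun k hk => ⟨_, _, hk, rfl⟩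
  have hd_le : ∀ n, ∀ x ∈ S n, d n ≤ ‖x‖ := fun n x hx => csInf_le (hbdd n) ⟨x, hx, rfl⟩
  have hdL : ∀ n, d n ≤ L := fun n =>
    ge_of_tendsto hL ((hSg n).mono fun k hk => hd_le n _ hk)
  have hdmono : Monotone d := fun m n hmn =>
    csInf_le_csInf (hbdd m) (hne n) (image_mono (hSanti hmn))
  have hdbdd : BddAbove (range d) := ⟨L, by rintro _ ⟨n, rfl⟩; exact hdL n⟩
  set D := ⨆ n, d n with hD
  have hdD : ∀ n, d n ≤ D := le_ciSup hdbdd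
  have hDL : D ≤ L := ciSup_le hdL
  have hD0 : 0 ≤ D :=
    (Real.sInf_nonneg (by rintro _ ⟨x, -, rfl⟩; exact norm_nonneg x)).trans (hdD 0)
  have hdlim : Tendsto d atTop (𝓝 D) := tendsto_atTop_ciSup hdmono hdbdd
  have hex : ∀ n : ℕ, ∃ h ∈ S n, ‖h‖ < D + 1 / ((n : ℝ) + 1) := fun n => by
    obtain ⟨_, ⟨h, hh, rfl⟩, hlt⟩ := exists_lt_of_csInf_lt (hne n)
      (show d n < D + 1 / ((n : ℝ) + 1) by
        linarith [hdD n, show (0 : ℝ) < 1 / ((n : ℝ) + 1) by positivity])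
    exact ⟨h, hh, hlt⟩
  choose h hhS hhD using hex
  have e0 : ∀ n : ℕ, (0 : ℝ) < 1 / ((n : ℝ) + 1) := fun n => by positivity
  -- The Cauchy criterion requires points of one ball, so the `h n` are scaled into the ball of
  -- radius `D`; the error is at most $1/(n+1)$.
  let x : ℕ → X := fun n => (D / (D + 1 / ((n : ℝ) + 1))) • h n
  have hxD : ∀ n, ‖x n‖ ≤ D := fun n => by
    have : 0 < D + 1 / ((n : ℝ) + 1) := by linarith [e0 n]
    rw [norm_smul, Real.norm_of_nonneg (by positivity), div_mul_eq_mul_div, div_le_iff₀ this]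
    exact mul_le_mul_of_nonneg_left (hhD n).le hD0
  have hxh : ∀ n, ‖x n - h n‖ ≤ 1 / ((n : ℝ) + 1) := fun n => by
    have h1 : 0 < D + 1 / ((n : ℝ) + 1) := by linarith [e0 n]
    have : x n - h n = -((1 / ((n : ℝ) + 1)) / (D + 1 / ((n : ℝ) + 1))) • h n := by
      have : D / (D + 1 / ((n : ℝ) + 1)) = 1 - (1 / ((n : ℝ) + 1)) / (D + 1 / ((n : ℝ) + 1)) := by
        rw [eq_sub_iff_add_eq, ← add_div, div_self h1.ne']
      simp only [x]
      rw [this]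
      module
    have e := (e0 n).le
    rw [this, norm_smul, norm_neg, Real.norm_of_nonneg (div_nonneg e h1.le), div_mul_eq_mul_div,
      div_le_iff₀ h1]
    exact mul_le_mul_of_nonneg_left (hhD n).le e
  have hsmall : Tendsto (fun n : ℕ => 1 / ((n : ℝ) + 1)) atTop (𝓝 0) :=
    tendsto_one_div_add_atTop_nhds_zero_nat
  have hcau : CauchySeq x := by
    refine cauchySeq_of_norm_add hxD fun η hη => ?_
    have e1 := hdlim.eventually (lt_mem_nhds (show D - η / 4 < D by linarith))
    have e2 := hsmall.eventually (gt_mem_nhds (show (0 : ℝ) < η / 4 by linarith))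
    obtain ⟨N, h1, h2⟩ := (e1.and e2).exists
    refine ⟨N, fun m hm n hn => ?_⟩
    -- The midpoint of `h m` and `h n` is still in `S N`, so $\|h_m + h_n\| \ge 2 d_N$, which is
    -- close to $2D$.
    have h3 := hd_le N _ (hSmid N _ (hSanti hm (hhS m)) _ (hSanti hn (hhS n)))
    rw [norm_smul, Real.norm_of_nonneg (by norm_num)] at h3
    have h4 : ‖h m + h n‖ ≤ ‖x m + x n‖ + ‖x m - h m‖ + ‖x n - h n‖ := by
      have : h m + h n = (x m + x n) - (x m - h m) - (x n - h n) := by abel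
      rw [this]
      exact (norm_sub_le _ _).trans (add_le_add_left (norm_sub_le _ _) _)
    have h5 := (hxh m).trans (Nat.one_div_le_one_div hm)
    have h6 := (hxh n).trans (Nat.one_div_le_one_div hn)
    linarith
  obtain ⟨g₀, hg₀⟩ := cauchySeq_tendsto_of_complete hcau
  refine ⟨g₀, ?_, (le_of_tendsto hg₀.norm (Eventually.of_forall hxD)).trans hDL⟩
  have hh₀ : Tendsto h atTop (𝓝 g₀) := by
    have h1 : Tendsto (fun n => x n - h n) atTop (𝓝 0) :=
      squeeze_zero_norm hxh hsmall
    simpa using hg₀.sub h1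
  have h2 : Tendsto (fun n => K (h n)) atTop (𝓝 u) :=
    tendsto_iff_norm_sub_tendsto_zero.2
      (squeeze_zero (fun _ => norm_nonneg _) (fun n => hhS n) hsmall)
  exact tendsto_nhds_unique ((K.continuous.tendsto g₀).comp hh₀) h2

end WeakCompactness

/-! ### The map $\phi_p$ and the derivative of $\|g\|^p$ on $L^p$. -/

namespace FracKirchhoff

section Phi

variable {p : ℝ}

theorem phi_eq (p s : ℝ) : phi p s = |s| ^ (p - 2) * s := by
  unfold phi
  split_ifs with h
  · simp [h]
  · rfl

theorem hasDerivAt_abs_rpow_phi (hp : 1 < p) (s : ℝ) :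
    HasDerivAt (fun x : ℝ => |x| ^ p) (p * phi p s) s := by
  simpa [phi_eq, mul_assoc] using hasDerivAt_abs_rpow s hp

/-- The factor $|s|^{p-2}$ is singular at $0$ when $p < 2$. Continuity comes instead from
$p\,\phi_p$ being the derivative of the $C^1$ function $|x|^p$. -/
theorem continuous_phi (hp : 1 < p) : Continuous (phi p) := by
  have h : Continuous (deriv fun x : ℝ => ‖x‖ ^ p) :=
    (contDiff_norm_rpow (E := ℝ) hp).continuous_deriv le_rfl
  have h2 : phi p = fun s => deriv (fun x : ℝ => ‖x‖ ^ p) s / p := by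
    ext s
    rw [show (fun x : ℝ => ‖x‖ ^ p) = fun x => |x| ^ p from rfl,
      (hasDerivAt_abs_rpow_phi hp s).deriv, mul_div_cancel_left₀ _ (by linarith)]
  rw [h2]
  exact h.div_const p

theorem abs_phi (hp : 1 < p) (s : ℝ) : |phi p s| = |s| ^ (p - 1) := by
  by_cases h : s = 0
  · simp [phi, h, Real.zero_rpow (by linarith : p - 1 ≠ 0)]
  · rw [phi_eq, abs_mul, abs_of_nonneg (Real.rpow_nonneg (abs_nonneg s) _),
      show p - 1 = p - 2 + 1 by ring, Real.rpow_add_one (abs_ne_zero.2 h)]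

theorem phi_mul_self (hp : 1 < p) (s : ℝ) : phi p s * s = |s| ^ p := by
  by_cases h : s = 0
  · simp [h, Real.zero_rpow (by linarith : p ≠ 0)]
  · rw [phi_eq, mul_assoc, ← sq, ← sq_abs, ← Real.rpow_natCast, ← Real.rpow_add (abs_pos.2 h)]
    norm_num

/-- A common bound for both factors does the work of Hölder's inequality: with $c$ a combination of
absolute values of $L^p$ functions, $c^p$ is an integrable majorant. -/
theorem abs_phi_mul_le (hp : 1 < p) {s r c : ℝ} (hs : |s| ≤ c) (hr : |r| ≤ c) :
    |phi p s * r| ≤ c ^ p := by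
  have hc : 0 ≤ c := (abs_nonneg s).trans hs
  rw [abs_mul, abs_phi hp, ← sub_add_cancel p 1, Real.rpow_add_one' hc (by linarith),
    sub_add_cancel p 1]
  exact mul_le_mul (Real.rpow_le_rpow (abs_nonneg _) hs (by linarith)) hr (abs_nonneg _)
    (Real.rpow_nonneg hc _)

end Phi

section Derivative

variable {Ω : Type*} [MeasurableSpace Ω] {μ : Measure Ω} {p : ℝ}

theorem integrable_linear_abs_rpow (hp : 1 < p) {g k l : Ω → ℝ}
    (hg : MemLp g (ENNReal.ofReal p) μ) (hk : MemLp k (ENNReal.ofReal p) μ)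
    (hl : MemLp l (ENNReal.ofReal p) μ) {M : ℝ} (hM : 0 ≤ M) :
    Integrable (fun t => (M * |g t| + M * |k t| + |l t|) ^ p) μ := by
  have h := (((hg.abs.const_mul M).add (hk.abs.const_mul M)).add hl.abs).integrable_abs_rpow
    (by linarith)
  refine h.congr (Eventually.of_forall fun t => ?_)
  change |(M * |g t| + M * |k t| + |l t|)| ^ p = _
  rw [abs_of_nonneg (by positivity)]

theorem integrable_phi_mul (hp : 1 < p) {g k : Ω → ℝ} (hg : MemLp g (ENNReal.ofReal p) μ)
    (hk : MemLp k (ENNReal.ofReal p) μ) : Integrable (fun t => phi p (g t) * k t) μ := by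
  refine (integrable_linear_abs_rpow hp hg hk hk zero_le_one).mono'
    (((continuous_phi hp).comp_aestronglyMeasurable hg.1).mul hk.1)
    (Eventually.of_forall fun t => abs_phi_mul_le hp ?_ ?_)
  all_goals linarith [abs_nonneg (g t), abs_nonneg (k t)]

theorem hasDerivAt_integral_abs_rpow (hp : 1 < p) {g k : Ω → ℝ}
    (hg : MemLp g (ENNReal.ofReal p) μ) (hk : MemLp k (ENNReal.ofReal p) μ) (y : ℝ) :
    HasDerivAt (fun y : ℝ => ∫ t, |g t + y * k t| ^ p ∂μ)
      (p * ∫ t, phi p (g t + y * k t) * k t ∂μ) y := by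
  have hy : ∀ y : ℝ, MemLp (fun t => g t + y * k t) (ENNReal.ofReal p) μ := fun y =>
    hg.add (hk.const_mul y)
  have hM : 0 ≤ |y| + 1 := by positivity
  have := (hasDerivAt_integral_of_dominated_loc_of_deriv_le (μ := μ)
    (F := fun y t => |g t + y * k t| ^ p) (F' := fun y t => p * (phi p (g t + y * k t) * k t))
    (x₀ := y) (s := Metric.ball y 1)
    (bound := fun t => p * ((|y| + 1 + 1) * |g t| + (|y| + 1 + 1) * |k t| + |k t|) ^ p)
    (Metric.ball_mem_nhds y one_pos)
    (Eventually.of_forall fun z => ((hy z).integrable_abs_rpow (by linarith)).1)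
    ((hy y).integrable_abs_rpow (by linarith))
    ((integrable_phi_mul hp (hy y) hk).const_mul p).1 ?_
    ((integrable_linear_abs_rpow hp hg hk hk (by positivity)).const_mul p) ?_).2
  · rwa [integral_const_mul] at this
  · refine Eventually.of_forall fun t z hz => ?_
    rw [norm_mul, Real.norm_of_nonneg (by linarith)]
    refine mul_le_mul_of_nonneg_left (abs_phi_mul_le hp ?_ ?_) (by linarith)
    · have hz' : |z| ≤ |y| + 1 := by
        have h1 : |z - y| < 1 := by simpa [Real.dist_eq] using hz
        have h2 := abs_sub_abs_le_abs_sub z y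
        linarith
      have h1 : |g t + z * k t| ≤ |g t| + |z| * |k t| := by
        rw [← abs_mul]; exact abs_add_le _ _
      have h2 : |z| * |k t| ≤ (|y| + 1) * |k t| := mul_le_mul_of_nonneg_right hz' (abs_nonneg _)
      nlinarith [abs_nonneg (g t), abs_nonneg (k t), abs_nonneg y,
        mul_nonneg (abs_nonneg y) (abs_nonneg (g t))]
    · nlinarith [abs_nonneg (g t), abs_nonneg (k t), abs_nonneg y,
        mul_nonneg (abs_nonneg y) (abs_nonneg (g t)), mul_nonneg (abs_nonneg y) (abs_nonneg (k t))]
  · refine Eventually.of_forall fun t z _ => ?_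
    have h1 : HasDerivAt (fun y : ℝ => g t + y * k t) (k t) z := by
      simpa using ((hasDerivAt_id z).mul_const (k t)).const_add (g t)
    have h2 := (hasDerivAt_abs_rpow_phi hp (g t + z * k t)).comp z h1
    rw [← mul_assoc]
    exact h2

/-- The Nehari argument moves only on rays and in planes, so continuity in two real parameters is
enough. On bounded parameter sets dominated convergence has an explicit majorant. -/
theorem continuous_integral_phi_mul (hp : 1 < p) {g k l : Ω → ℝ}
    (hg : MemLp g (ENNReal.ofReal p) μ) (hk : MemLp k (ENNReal.ofReal p) μ)
    (hl : MemLp l (ENNReal.ofReal p) μ) :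
    Continuous fun z : ℝ × ℝ => ∫ t, phi p (z.1 * g t + z.2 * k t) * l t ∂μ := by
  refine continuous_iff_continuousAt.2 fun z₀ => ?_
  refine continuousAt_of_dominated
    (bound := fun t => ((‖z₀‖ + 1) * |g t| + (‖z₀‖ + 1) * |k t| + |l t|) ^ p) ?_ ?_
    (integrable_linear_abs_rpow hp hg hk hl (by positivity)) ?_
  · exact Eventually.of_forall fun z =>
      (integrable_phi_mul hp ((hg.const_mul z.1).add (hk.const_mul z.2)) hl).1
  · filter_upwards [Metric.ball_mem_nhds z₀ one_pos] with z hz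
    refine Eventually.of_forall fun t => abs_phi_mul_le hp ?_ ?_
    · have hz' : ‖z‖ ≤ ‖z₀‖ + 1 := by
        have h1 : ‖z - z₀‖ < 1 := by simpa [dist_eq_norm] using hz
        linarith [norm_sub_norm_le z z₀]
      have h1 : |z.1 * g t + z.2 * k t| ≤ |z.1| * |g t| + |z.2| * |k t| := by
        rw [← abs_mul, ← abs_mul]; exact abs_add_le _ _
      have h2 : |z.1| * |g t| ≤ (‖z₀‖ + 1) * |g t| :=
        mul_le_mul_of_nonneg_right ((norm_fst_le z).trans hz') (abs_nonneg _)
      have h3 : |z.2| * |k t| ≤ (‖z₀‖ + 1) * |k t| :=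
        mul_le_mul_of_nonneg_right ((norm_snd_le z).trans hz') (abs_nonneg _)
      linarith [abs_nonneg (l t)]
    · have : 0 ≤ (‖z₀‖ + 1) * |g t| + (‖z₀‖ + 1) * |k t| := by positivity
      linarith
  · refine Eventually.of_forall fun t => Continuous.continuousAt ?_
    exact ((continuous_phi hp).comp (by fun_prop)).mul continuous_const

/-- The Gateaux derivative of `g ↦ ‖g‖ ^ p / p` on `L^p`. -/
noncomputable def duality (hp : 1 < p) (g : Lp ℝ (ENNReal.ofReal p) μ) :
    Lp ℝ (ENNReal.ofReal p) μ →ₗ[ℝ] ℝ where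
  toFun k := ∫ t, phi p (g t) * k t ∂μ
  map_add' k l := by
    rw [← integral_add (integrable_phi_mul hp (Lp.memLp g) (Lp.memLp k))
      (integrable_phi_mul hp (Lp.memLp g) (Lp.memLp l))]
    refine integral_congr_ae ?_
    filter_upwards [Lp.coeFn_add k l] with t ht
    rw [ht, Pi.add_apply, mul_add]
  map_smul' c k := by
    rw [RingHom.id_apply, smul_eq_mul, ← integral_const_mul]
    refine integral_congr_ae ?_
    filter_upwards [Lp.coeFn_smul c k] with t ht
    rw [ht, Pi.smul_apply, smul_eq_mul]
    ring

theorem duality_apply (hp : 1 < p) (g k : Lp ℝ (ENNReal.ofReal p) μ) :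
    duality hp g k = ∫ t, phi p (g t) * k t ∂μ := rfl

theorem duality_self (hp : 1 < p) (g : Lp ℝ (ENNReal.ofReal p) μ) :
    duality hp g g = ‖g‖ ^ p := by
  rw [duality_apply, Lp.norm_rpow_eq_integral (by linarith)]
  simp only [phi_mul_self hp]

theorem hasDerivAt_norm_rpow_Lp (hp : 1 < p) [Fact (1 ≤ ENNReal.ofReal p)]
    (g k : Lp ℝ (ENNReal.ofReal p) μ) (y : ℝ) :
    HasDerivAt (fun y : ℝ => ‖g + y • k‖ ^ p) (p * duality hp (g + y • k) k) y := by
  have hae : ∀ y : ℝ, (g + y • k : Lp ℝ (ENNReal.ofReal p) μ) =ᵐ[μ] fun t => g t + y * k t :=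
    fun y => by
      filter_upwards [Lp.coeFn_add g (y • k), Lp.coeFn_smul y k] with t h1 h2
      rw [h1, Pi.add_apply, h2, Pi.smul_apply, smul_eq_mul]
  have h1 : (fun y : ℝ => ‖g + y • k‖ ^ p) = fun y : ℝ => ∫ t, |g t + y * k t| ^ p ∂μ := by
    ext y
    rw [Lp.norm_rpow_eq_integral (by linarith)]
    refine integral_congr_ae ?_
    filter_upwards [hae y] with t ht
    rw [ht]
  have h2 : duality hp (g + y • k) k = ∫ t, phi p (g t + y * k t) * k t ∂μ := by
    refine integral_congr_ae ?_
    filter_upwards [hae y] with t ht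
    rw [ht]
  rw [h1, h2]
  exact hasDerivAt_integral_abs_rpow hp (Lp.memLp g) (Lp.memLp k) y

theorem continuous_duality_comb (hp : 1 < p) [Fact (1 ≤ ENNReal.ofReal p)]
    (g k l : Lp ℝ (ENNReal.ofReal p) μ) :
    Continuous fun z : ℝ × ℝ => duality hp (z.1 • g + z.2 • k) l := by
  refine (continuous_integral_phi_mul hp (Lp.memLp g) (Lp.memLp k) (Lp.memLp l)).congr fun z => ?_
  refine integral_congr_ae ?_
  filter_upwards [Lp.coeFn_add (z.1 • g) (z.2 • k), Lp.coeFn_smul z.1 g, Lp.coeFn_smul z.2 k]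
    with t h1 h2 h3
  rw [h1, Pi.add_apply, h2, h3, Pi.smul_apply, Pi.smul_apply, smul_eq_mul, smul_eq_mul]

end Derivative

end FracKirchhoff

/-! ### Pointwise consequences of the monotonicity and growth conditions. -/

namespace FracKirchhoff

section Scalar

variable {f : ℝ → ℝ} {r : ℝ}

/-- Compare the quotients at $sx$ and $x$, then multiply by $x$. For $x < 0$ both the order of the
two points and the multiplication reverse the inequality, so both signs of $x$ give the same result.
-/
theorem comp_mul_mul_le_of_strictMonoOn
    (hmono : StrictMonoOn (fun x : ℝ => f x / |x| ^ r) {0}ᶜ) {s : ℝ} (hs : 0 < s) (hs1 : s ≤ 1)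
    (x : ℝ) : f (s * x) * x ≤ s ^ r * (f x * x) := by
  rcases eq_or_ne x 0 with rfl | hx
  · simp
  have hsx : s * x ≠ 0 := mul_ne_zero hs.ne' hx
  have hxr : 0 < |x| ^ r := Real.rpow_pos_of_pos (abs_pos.2 hx) r
  have hsr : 0 < s ^ r := Real.rpow_pos_of_pos hs r
  have hab : |s * x| ^ r = s ^ r * |x| ^ r := by
    rw [abs_mul, abs_of_pos hs, Real.mul_rpow hs.le (abs_nonneg x)]
  have hd : f (s * x) * x / (s ^ r * |x| ^ r) ≤ f x * x / |x| ^ r := by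
    rw [← hab, mul_div_right_comm, mul_div_right_comm]
    rcases lt_or_gt_of_ne hx with h | h
    · refine mul_le_mul_of_nonpos_right (hmono.monotoneOn hx hsx ?_) h.le
      nlinarith
    · refine mul_le_mul_of_nonneg_right (hmono.monotoneOn hsx hx ?_) h.le
      nlinarith
  rw [div_le_div_iff₀ (by positivity) hxr] at hd
  have : f (s * x) * x * |x| ^ r ≤ s ^ r * (f x * x) * |x| ^ r := by linarith
  exact le_of_mul_le_mul_right this hxr

/-- This is the previous bound with factor $s^{-1}$ at the point $sx$. -/
theorem le_comp_mul_mul_of_strictMonoOn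
    (hmono : StrictMonoOn (fun x : ℝ => f x / |x| ^ r) {0}ᶜ) {s : ℝ} (hs1 : 1 ≤ s) (x : ℝ) :
    s ^ r * (f x * x) ≤ f (s * x) * x := by
  have hs : 0 < s := by linarith
  have h := comp_mul_mul_le_of_strictMonoOn hmono (inv_pos.2 hs) (inv_le_one_of_one_le₀ hs1) (s * x)
  rw [inv_mul_cancel_left₀ hs.ne', Real.inv_rpow hs.le] at h
  have hsr : 0 < s ^ r := Real.rpow_pos_of_pos hs r
  rw [inv_mul_eq_div, le_div_iff₀ hsr] at h
  refine le_of_mul_le_mul_left ?_ hs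
  linarith

theorem integral_eq_integral_comp_mul (f : ℝ → ℝ) (x : ℝ) :
    ∫ s in (0 : ℝ)..x, f s = ∫ s in (0 : ℝ)..1, f (s * x) * x := by
  rw [intervalIntegral.integral_mul_const, mul_comm, intervalIntegral.mul_integral_comp_mul_right]
  simp

/-- Write $F(x) = \int_0^1 f(sx)x\,ds$, bound the integrand by $s^r x f(x)$ and integrate $s^r$. For
$r = p^2 - 1$ this is $p^2F \le xf$, without restriction on $|x|$. -/
theorem mul_integral_le_of_strictMonoOn (hf : Continuous f) (hr : 0 < r)
    (hmono : StrictMonoOn (fun x : ℝ => f x / |x| ^ r) {0}ᶜ) (x : ℝ) :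
    (r + 1) * ∫ s in (0 : ℝ)..x, f s ≤ x * f x := by
  have h : ∫ s in (0 : ℝ)..1, f (s * x) * x ≤ ∫ s in (0 : ℝ)..1, s ^ r * (f x * x) := by
    refine intervalIntegral.integral_mono_on_of_le_Ioo zero_le_one
      (Continuous.intervalIntegrable (by fun_prop) _ _)
      (((continuous_id.rpow_const fun _ => Or.inr hr.le).mul
        continuous_const).intervalIntegrable _ _) fun s hs =>
      comp_mul_mul_le_of_strictMonoOn hmono hs.1 hs.2.le x
  rw [← integral_eq_integral_comp_mul, intervalIntegral.integral_mul_const,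
    integral_rpow (Or.inl (by linarith)), Real.one_rpow,
    Real.zero_rpow (by linarith), sub_zero, one_div,
    inv_mul_eq_div, le_div_iff₀ (by linarith)] at h
  linarith

theorem hasDerivAt_primitive (hf : Continuous f) (x : ℝ) :
    HasDerivAt (fun x : ℝ => ∫ s in (0 : ℝ)..x, f s) (f x) x :=
  intervalIntegral.integral_hasDerivAt_right (hf.intervalIntegrable _ _)
    (hf.stronglyMeasurableAtFilter _ _) hf.continuousAt

/-- The growth of the primitive that follows from the Ambrosetti–Rabinowitz condition. -/
theorem rpow_mul_primitive_le (hf : Continuous f) {μ R x : ℝ}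
    (h : ∀ x, R ≤ |x| → μ * (∫ s in (0 : ℝ)..x, f s) ≤ x * f x) (hx : R ≤ |x|) {s : ℝ}
    (hs : 1 ≤ s) : s ^ μ * (∫ s in (0 : ℝ)..x, f s) ≤ ∫ s in (0 : ℝ)..(s * x), f s := by
  set F : ℝ → ℝ := fun x => ∫ s in (0 : ℝ)..x, f s with hF
  have hd : ∀ s ∈ Ici (1 : ℝ), HasDerivAt (fun s => F (s * x) * s ^ (-μ))
      (f (s * x) * x * s ^ (-μ) + F (s * x) * (-μ * s ^ (-μ - 1))) s := fun s hs => by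
    have h1 : HasDerivAt (fun s : ℝ => s * x) x s := by simpa using (hasDerivAt_id s).mul_const x
    have h2 := (hasDerivAt_primitive hf (s * x)).comp s h1
    have h0 : s ≠ 0 := (zero_lt_one.trans_le hs).ne'
    exact h2.mul (Real.hasDerivAt_rpow_const (Or.inl h0))
  -- The derivative of $s^{-\mu}F(sx)$ is $s^{-\mu-1}$ times $sx f(sx) - \mu F(sx)$, which is
  -- nonnegative because $|sx| \ge R$.
  have hm : MonotoneOn (fun s => F (s * x) * s ^ (-μ)) (Ici 1) := by
    refine monotoneOn_of_deriv_nonneg (convex_Ici 1)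
      (fun s hs => (hd s hs).continuousAt.continuousWithinAt)
      (fun s hs => (hd s (interior_subset hs)).differentiableAt.differentiableWithinAt)
      fun s hs => ?_
    have hs1 : (1 : ℝ) ≤ s := interior_subset hs
    have hs0 : 0 < s := by linarith
    rw [(hd s hs1).deriv]
    have h3 := h (s * x) (by
      rw [abs_mul, abs_of_pos hs0]
      nlinarith [abs_nonneg x])
    have h4 : s ^ (-μ) = s ^ (-μ - 1) * s := by
      rw [← Real.rpow_add_one hs0.ne']; ring_nf
    have h5 : 0 ≤ s ^ (-μ - 1) * (s * x * f (s * x) - μ * F (s * x)) :=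
      mul_nonneg (Real.rpow_nonneg hs0.le _) (sub_nonneg.2 h3)
    rw [h4]
    linarith
  have h1 := hm self_mem_Ici (show s ∈ Ici 1 from hs) hs
  have hs0 : 0 < s := by linarith
  simp only [one_mul, Real.one_rpow, mul_one] at h1
  rw [Real.rpow_neg hs0.le, ← div_eq_mul_inv, le_div_iff₀ (Real.rpow_pos_of_pos hs0 _)] at h1
  linarith

end Scalar

/-! ### Superposition operators on continuous functions. -/

section Nemytskii

variable {Ω : Type*} [TopologicalSpace Ω]

/-- The primitive of `f w` that vanishes at `0`. -/
noncomputable def primOn (f : Ω → ℝ → ℝ) (w : Ω) (x : ℝ) : ℝ := ∫ s in (0 : ℝ)..x, f w s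

/-- Rescaling to the fixed interval $[0,1]$ moves the variable endpoint into the integrand. -/
theorem continuous_primOn {f : Ω → ℝ → ℝ} (hf : Continuous (Function.uncurry f)) :
    Continuous (Function.uncurry (primOn f)) := by
  have : Function.uncurry (primOn f) =
      fun z : Ω × ℝ => ∫ s in (0 : ℝ)..1, f z.1 (s * z.2) * z.2 := by
    ext ⟨w, x⟩
    exact integral_eq_integral_comp_mul (f w) x
  rw [this]
  refine intervalIntegral.continuous_parametric_intervalIntegral_of_continuous' ?_ 0 1
  have h : Continuous fun q : (Ω × ℝ) × ℝ => Function.uncurry f (q.1.1, q.2 * q.1.2) :=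
    hf.comp (by fun_prop)
  exact h.mul (by fun_prop)

/-- The superposition operator `u ↦ g(·, u(·))`. -/
def nemytskii (g : Ω → ℝ → ℝ) (hg : Continuous (Function.uncurry g)) (u : C(Ω, ℝ)) : C(Ω, ℝ) :=
  ⟨fun w => g w (u w), hg.comp (continuous_id.prodMk u.continuous)⟩

theorem continuous_nemytskii [CompactSpace Ω] [T2Space Ω] {g : Ω → ℝ → ℝ}
    (hg : Continuous (Function.uncurry g)) :
    Continuous (nemytskii g hg) := by
  refine ContinuousMap.continuous_of_continuous_uncurry _ ?_
  exact hg.comp (continuous_snd.prodMk continuous_eval)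

variable [CompactSpace Ω] [MeasurableSpace Ω] [BorelSpace Ω] {m : Measure Ω} [IsFiniteMeasure m]

theorem ContinuousMap.integrable (u : C(Ω, ℝ)) : Integrable u m :=
  Integrable.of_bound u.continuous.aestronglyMeasurable ‖u‖
    (Eventually.of_forall u.norm_coe_le_norm)

theorem continuous_integral_continuousMap : Continuous fun u : C(Ω, ℝ) => ∫ w, u w ∂m := by
  refine (LipschitzWith.of_dist_le_mul (K := ⟨m.real univ, measureReal_nonneg⟩)
    fun u v => ?_).continuous
  rw [Real.dist_eq, ← integral_sub (ContinuousMap.integrable u) (ContinuousMap.integrable v),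
    dist_eq_norm, mul_comm]
  refine norm_integral_le_of_norm_le_const (μ := m) (f := fun w => u w - v w)
    (Eventually.of_forall fun w => ?_)
  exact (u - v).norm_coe_le_norm w

theorem continuous_integral_nemytskii [T2Space Ω] {g : Ω → ℝ → ℝ}
    (hg : Continuous (Function.uncurry g)) :
    Continuous fun u : C(Ω, ℝ) => ∫ w, g w (u w) ∂m :=
  continuous_integral_continuousMap.comp (continuous_nemytskii hg)

theorem continuous_integral_nemytskii_mul [T2Space Ω] {g : Ω → ℝ → ℝ}
    (hg : Continuous (Function.uncurry g)) :
    Continuous fun z : C(Ω, ℝ) × C(Ω, ℝ) => ∫ w, g w (z.1 w) * z.2 w ∂m :=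
  continuous_integral_continuousMap.comp
    (((continuous_nemytskii hg).comp continuous_fst).mul continuous_snd)

/-- Differentiation under the integral: on a compact parameter interval and compact $\Omega$ the
derivative of the integrand is bounded by a constant. -/
theorem hasDerivAt_integral_primOn {f : Ω → ℝ → ℝ} (hf : Continuous (Function.uncurry f))
    (u v : C(Ω, ℝ)) (y : ℝ) :
    HasDerivAt (fun y : ℝ => ∫ w, primOn f w (u w + y * v w) ∂m)
      (∫ w, f w (u w + y * v w) * v w ∂m) y := by
  have hF' : Continuous fun z : ℝ × Ω => f z.2 (u z.2 + z.1 * v z.2) * v z.2 := by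
    have : Continuous fun z : ℝ × Ω => Function.uncurry f (z.2, u z.2 + z.1 * v z.2) :=
      hf.comp (by fun_prop)
    exact this.mul (by fun_prop)
  obtain ⟨M, hM⟩ := ((isCompact_closedBall y 1).prod
    (isCompact_univ (X := Ω))).exists_bound_of_continuousOn
    hF'.continuousOn
  have hint : ∀ z : ℝ, Integrable (fun w => primOn f w (u w + z * v w)) m := fun z =>
    ContinuousMap.integrable (nemytskii (primOn f) (continuous_primOn hf) (u + z • v))
  refine (hasDerivAt_integral_of_dominated_loc_of_deriv_le (μ := m)
    (F := fun y w => primOn f w (u w + y * v w)) (F' := fun y w => f w (u w + y * v w) * v w)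
    (bound := fun _ => M) (Metric.closedBall_mem_nhds y one_pos)
    (Eventually.of_forall fun z => (hint z).1) (hint y) ?_ ?_ (integrable_const M) ?_).2
  · exact (hF'.comp (by fun_prop : Continuous fun w : Ω => (y, w))).aestronglyMeasurable
  · exact Eventually.of_forall fun w z hz => hM (z, w) ⟨hz, mem_univ _⟩
  · refine Eventually.of_forall fun w z _ => ?_
    have h1 : HasDerivAt (fun y : ℝ => u w + y * v w) (v w) z := by
      simpa using ((hasDerivAt_id z).mul_const (v w)).const_add (u w)
    have hfw : Continuous (f w) := hf.comp (by fun_prop : Continuous fun x : ℝ => (w, x))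
    exact (hasDerivAt_primitive hfw (u w + z * v w)).comp z h1

omit [MeasurableSpace Ω] [BorelSpace Ω] in
-- On $|x| = R$ the primitive has a positive minimum $c_0$ by compactness, and
-- `rpow_mul_primitive_le` propagates it to $F \ge c_0(|x|/R)^\mu$ outside. The hypothesis turns
-- this into a bound for $xf$; the constant $C$ covers $|x| \le R$.
theorem exists_rpow_sub_le {f : Ω → ℝ → ℝ} (hf : Continuous (Function.uncurry f)) {μ R : ℝ}
    (hμ : 0 < μ) (hR : 0 < R)
    (hAR : ∀ w x, R ≤ |x| → 0 < μ * primOn f w x ∧ μ * primOn f w x ≤ x * f w x) :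
    ∃ c C : ℝ, 0 < c ∧ ∀ w x, c * |x| ^ μ - C ≤ x * f w x := by
  rcases isEmpty_or_nonempty Ω with hΩ | hΩ
  · exact ⟨1, 0, one_pos, fun w => hΩ.elim w⟩
  have hfw : ∀ w, Continuous (f w) := fun w =>
    hf.comp (by fun_prop : Continuous fun x : ℝ => (w, x))
  have hS : IsCompact ((univ : Set Ω) ×ˢ Metric.sphere (0 : ℝ) R) :=
    isCompact_univ.prod (isCompact_sphere 0 R)
  obtain ⟨z₀, hz₀, hmin⟩ := hS.exists_isMinOn
    ⟨(hΩ.some, R), mem_univ _, by simp [abs_of_pos hR]⟩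
    ((continuous_primOn hf).continuousOn)
  set c₀ := Function.uncurry (primOn f) z₀ with hc₀
  have hc₀pos : 0 < c₀ := by
    have := (hAR z₀.1 z₀.2 (by simpa using hz₀.2.ge)).1
    exact pos_of_mul_pos_right this hμ.le
  obtain ⟨M, hM⟩ := ((isCompact_univ (X := Ω)).prod
    (isCompact_closedBall (0 : ℝ) R)).exists_bound_of_continuousOn
    (f := fun z : Ω × ℝ => z.2 * Function.uncurry f z) (continuous_snd.mul hf).continuousOn
  have hRμ : 0 < R ^ μ := Real.rpow_pos_of_pos hR μ
  refine ⟨μ * c₀ / R ^ μ, M + μ * c₀, by positivity, fun w x => ?_⟩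
  have hM0 : 0 ≤ M := (norm_nonneg _).trans (hM (w, 0) ⟨mem_univ _, by simp [hR.le]⟩)
  rcases le_total R |x| with hx | hx
  · have hx0 : 0 < |x| := hR.trans_le hx
    set s := |x| / R with hs
    have hs1 : 1 ≤ s := (one_le_div hR).2 hx
    have hs0 : 0 < s := by linarith
    have hxs : |x / s| = R := by
      rw [abs_div, abs_of_pos hs0, hs, div_div_cancel₀ hx0.ne']
    have h1 := rpow_mul_primitive_le (hfw w) (fun x hx => (hAR w x hx).2) hxs.ge hs1
    rw [mul_div_cancel₀ _ hs0.ne'] at h1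
    have h2 : c₀ ≤ primOn f w (x / s) :=
      hmin (show (w, x / s) ∈ _ from ⟨mem_univ _, by rw [mem_sphere_zero_iff_norm]; exact hxs⟩)
    have h3 : s ^ μ * c₀ ≤ primOn f w x :=
      (mul_le_mul_of_nonneg_left h2 (Real.rpow_nonneg hs0.le _)).trans h1
    have h4 : s ^ μ = |x| ^ μ / R ^ μ := Real.div_rpow hx0.le hR.le μ
    have h5 : μ * c₀ / R ^ μ * |x| ^ μ = μ * (s ^ μ * c₀) := by rw [h4]; ring
    rw [h5]
    have h6 := (hAR w x hx).2
    have h7 := mul_le_mul_of_nonneg_left h3 hμ.le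
    have h8 : 0 < μ * c₀ := by positivity
    linarith
  · have h1 := (abs_le.1 (hM (w, x) ⟨mem_univ _, by simpa using hx⟩)).1
    have h2 : |x| ^ μ ≤ R ^ μ := Real.rpow_le_rpow (abs_nonneg _) hx hμ.le
    have h3 : μ * c₀ / R ^ μ * |x| ^ μ ≤ μ * c₀ := by
      rw [div_mul_eq_mul_div, div_le_iff₀ hRμ]
      exact mul_le_mul_of_nonneg_left h2 (by positivity)
    simp only [Function.uncurry] at h1
    linarith

omit [BorelSpace Ω] in
theorem abs_integral_nemytskii_mul_le {f : Ω → ℝ → ℝ} {p ε δ : ℝ} (hp : 0 < p) (hε : 0 ≤ ε)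
    (hsmall : ∀ w x, |x| < δ → |f w x * x| ≤ ε * |x| ^ p) {u : C(Ω, ℝ)} (hu : ‖u‖ < δ) :
    |∫ w, f w (u w) * u w ∂m| ≤ ε * ‖u‖ ^ p * m.real univ := by
  refine norm_integral_le_of_norm_le_const (μ := m) (f := fun w => f w (u w) * u w)
    (Eventually.of_forall fun w => ?_)
  have h := u.norm_coe_le_norm w
  exact (hsmall w (u w) (h.trans_lt hu)).trans
    (mul_le_mul_of_nonneg_left (Real.rpow_le_rpow (abs_nonneg _) h hp.le) hε)

end Nemytskii

end FracKirchhoff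

/-! ### The abstract Kirchhoff functional and its Nehari manifold. -/

namespace FracKirchhoff

/-- The data of an abstract Kirchhoff-type functional: a compact linear map `K` from a Banach space
to continuous functions, the Gateaux derivative `D` of `‖·‖ ^ p / p`, and the nonlinearity `f`. -/
structure KirchhoffData (Ω X : Type*) [TopologicalSpace Ω] [CompactSpace Ω] [MeasurableSpace Ω]
    (m : Measure Ω) [NormedAddCommGroup X] [NormedSpace ℝ X] where
  a : ℝ
  b : ℝ
  p : ℝ
  K : X →L[ℝ] C(Ω, ℝ)
  D : X → X →ₗ[ℝ] ℝ
  f : Ω → ℝ → ℝ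
  a_pos : 0 < a
  b_pos : 0 < b
  one_lt_p : 1 < p
  compact : IsCompactOperator K
  injective : ∀ g, (K g =ᵐ[m] fun _ => 0) → g = 0
  D_self : ∀ g, D g g = ‖g‖ ^ p
  hasDerivAt_norm : ∀ g k (y : ℝ),
    HasDerivAt (fun y : ℝ => ‖g + y • k‖ ^ p) (p * D (g + y • k) k) y
  continuous_D : ∀ g k l, Continuous fun z : ℝ × ℝ => D (z.1 • g + z.2 • k) l
  continuous_f : Continuous (Function.uncurry f)
  strictMono : ∀ w, StrictMonoOn (fun x : ℝ => f w x / |x| ^ (p ^ 2 - 1)) {0}ᶜ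
  small : ∀ ε : ℝ, 0 < ε → ∃ δ : ℝ, 0 < δ ∧ ∀ w x, 0 < |x| → |x| < δ →
    |f w x| ≤ ε * |x| ^ (p - 1)
  superlinear : ∃ μ R : ℝ, p ^ 2 < μ ∧ 0 < R ∧ ∀ w x, R ≤ |x| →
    0 < μ * primOn f w x ∧ μ * primOn f w x ≤ x * f w x

namespace KirchhoffData

variable {Ω X : Type*} [TopologicalSpace Ω] [CompactSpace Ω] [MeasurableSpace Ω]
  {m : Measure Ω} [NormedAddCommGroup X] [NormedSpace ℝ X] (S : KirchhoffData Ω X m)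

/-- The energy functional. -/
noncomputable def E (g : X) : ℝ :=
  1 / (S.b * S.p ^ 2) * (S.a + S.b * ‖g‖ ^ S.p) ^ S.p - (∫ w, primOn S.f w (S.K g w) ∂m) -
    S.a ^ S.p / (S.b * S.p ^ 2)

/-- The first variation of the energy functional. -/
noncomputable def dE (g k : X) : ℝ :=
  (S.a + S.b * ‖g‖ ^ S.p) ^ (S.p - 1) * S.D g k - ∫ w, S.f w (S.K g w) * S.K k w ∂m

/-- The Nehari manifold. -/
def N : Set X := {g | g ≠ 0 ∧ S.dE g g = 0}

theorem p_pos : 0 < S.p := zero_lt_one.trans S.one_lt_p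

theorem base_pos (g : X) : 0 < S.a + S.b * ‖g‖ ^ S.p :=
  add_pos_of_pos_of_nonneg S.a_pos
    (mul_nonneg S.b_pos.le (Real.rpow_nonneg (norm_nonneg g) S.p))

theorem exponent_pos : 0 < S.p ^ 2 - 1 := by nlinarith [S.one_lt_p]

theorem norm_rpow_pos {g : X} (hg : g ≠ 0) : 0 < ‖g‖ ^ S.p :=
  Real.rpow_pos_of_pos (norm_pos_iff.2 hg) _

/-- This is the scaling of $(b\|g\|^p)^{p-1}\|g\|^{p-1}$, the dominant part of the Kirchhoff term;
it explains the exponent $p^2 - 1$ in the monotonicity condition. -/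
theorem rpow_exponent {s : ℝ} (hs : 0 < s) :
    s ^ (S.p ^ 2 - 1) = (s ^ S.p) ^ (S.p - 1) * s ^ (S.p - 1) := by
  rw [← Real.rpow_mul hs.le, ← Real.rpow_add hs]
  ring_nf

variable [BorelSpace Ω] [IsFiniteMeasure m]

theorem integrable_f_mul (u v : C(Ω, ℝ)) : Integrable (fun w => S.f w (u w) * v w) m :=
  ContinuousMap.integrable (nemytskii S.f S.continuous_f u * v)

theorem integrable_primOn (u : C(Ω, ℝ)) : Integrable (fun w => primOn S.f w (u w)) m :=
  ContinuousMap.integrable (nemytskii (primOn S.f) (continuous_primOn S.continuous_f) u)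

theorem dE_add (g k l : X) : S.dE g (k + l) = S.dE g k + S.dE g l := by
  simp only [dE, map_add, ContinuousMap.add_apply, mul_add]
  rw [integral_add (S.integrable_f_mul _ _) (S.integrable_f_mul _ _)]
  ring

omit [BorelSpace Ω] [IsFiniteMeasure m] in
theorem dE_smul (g k : X) (c : ℝ) : S.dE g (c • k) = c * S.dE g k := by
  simp only [dE, map_smul, ContinuousMap.smul_apply, smul_eq_mul, mul_left_comm _ c,
    integral_const_mul]
  ring

theorem hasDerivAt_E (g k : X) (y : ℝ) :
    HasDerivAt (fun y : ℝ => S.E (g + y • k)) (S.dE (g + y • k) k) y := by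
  have h1 := ((((S.hasDerivAt_norm g k y).const_mul S.b).const_add S.a).rpow_const (p := S.p)
    (Or.inl (S.base_pos (g + y • k)).ne')).const_mul (1 / (S.b * S.p ^ 2))
  have h2 := hasDerivAt_integral_primOn (m := m) S.continuous_f (S.K g) (S.K k) y
  have h3 := (h1.sub h2).sub_const (S.a ^ S.p / (S.b * S.p ^ 2))
  have e : S.dE (g + y • k) k = 1 / (S.b * S.p ^ 2) * (S.b * (S.p * S.D (g + y • k) k) * S.p *
      (S.a + S.b * ‖g + y • k‖ ^ S.p) ^ (S.p - 1)) -
      ∫ w, S.f w (S.K g w + y * S.K k w) * S.K k w ∂m := by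
    have hb := S.b_pos.ne'
    have hp := S.p_pos.ne'
    simp only [dE, map_add, map_smul, ContinuousMap.add_apply, ContinuousMap.smul_apply,
      smul_eq_mul]
    congr 1
    field_simp
  rw [e]
  refine h3.congr_of_eventuallyEq (Eventually.of_forall fun y => ?_)
  simp only [E, map_add, map_smul, ContinuousMap.add_apply, ContinuousMap.smul_apply, smul_eq_mul,
    Pi.sub_apply]

theorem hasDerivAt_E_smul (g : X) (s : ℝ) :
    HasDerivAt (fun s : ℝ => S.E (s • g)) (S.dE (s • g) g) s := by
  simpa using S.hasDerivAt_E 0 g s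

section Continuity

variable [T2Space Ω]

theorem continuous_dE_comb (g k l : X) :
    Continuous fun z : ℝ × ℝ => S.dE (z.1 • g + z.2 • k) l := by
  have h0 : Continuous fun z : ℝ × ℝ => z.1 • g + z.2 • k := by fun_prop
  have h1 : Continuous fun z : ℝ × ℝ => (S.a + S.b * ‖z.1 • g + z.2 • k‖ ^ S.p) ^ (S.p - 1) :=
    (continuous_const.add (continuous_const.mul
      (h0.norm.rpow_const fun _ => Or.inr S.p_pos.le))).rpow_const
      fun _ => Or.inr (sub_pos.2 S.one_lt_p).le
  have h2 : Continuous fun z : ℝ × ℝ => (S.K (z.1 • g + z.2 • k), S.K l) :=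
    (S.K.continuous.comp h0).prodMk continuous_const
  exact (h1.mul (S.continuous_D g k l)).sub
    ((continuous_integral_nemytskii_mul S.continuous_f).comp h2)

theorem continuous_dE_smul (g l : X) : Continuous fun s : ℝ => S.dE (s • g) l := by
  have := (S.continuous_dE_comb g 0 l).comp (by fun_prop : Continuous fun s : ℝ => (s, (0 : ℝ)))
  simpa [Function.comp_def] using this

theorem continuous_dE_comb_self (g k : X) :
    Continuous fun z : ℝ × ℝ => S.dE (z.1 • g + z.2 • k) (z.1 • g + z.2 • k) := by
  simp only [dE_add, dE_smul]
  exact (continuous_fst.mul (S.continuous_dE_comb g k g)).add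
    (continuous_snd.mul (S.continuous_dE_comb g k k))

end Continuity

omit [BorelSpace Ω] [IsFiniteMeasure m] in
theorem dE_smul_self {s : ℝ} (hs : 0 < s) (g : X) :
    S.dE (s • g) g = (S.a + S.b * (s ^ S.p * ‖g‖ ^ S.p)) ^ (S.p - 1) *
      (s ^ (S.p - 1) * ‖g‖ ^ S.p) - ∫ w, S.f w (s * S.K g w) * S.K g w ∂m := by
  have h1 : ‖s • g‖ ^ S.p = s ^ S.p * ‖g‖ ^ S.p := by
    rw [norm_smul, Real.norm_of_nonneg hs.le, Real.mul_rpow hs.le (norm_nonneg g)]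
  -- `D (s • g)` is linear, so its value at `g` is that at `s • g`, known from `D_self`, divided by
  -- `s`.
  have h2 : S.D (s • g) g = s ^ (S.p - 1) * ‖g‖ ^ S.p := by
    have := S.D_self (s • g)
    rw [map_smul, smul_eq_mul, h1] at this
    rw [Real.rpow_sub_one hs.ne', div_mul_eq_mul_div, eq_div_iff hs.ne', ← this, mul_comm]
  simp only [dE, h1, h2, map_smul, ContinuousMap.smul_apply, smul_eq_mul]

omit [BorelSpace Ω] [IsFiniteMeasure m] in
theorem dE_self (g : X) : S.dE g g =
    (S.a + S.b * ‖g‖ ^ S.p) ^ (S.p - 1) * ‖g‖ ^ S.p - ∫ w, S.f w (S.K g w) * S.K g w ∂m := by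
  rw [dE, S.D_self]

/-- At a Nehari point the two terms balance. Under scaling by $s < 1$ the nonlinear one is at most
$s^{p^2-1}$ times its old value, while the Kirchhoff one is strictly more, because $a + bs^pA >
s^p(a + bA)$ for $a > 0$, where $A = \|g\|^p$. -/
theorem dE_smul_pos {g : X} (hg : g ∈ S.N) {s : ℝ} (hs : 0 < s) (hs1 : s < 1) :
    0 < S.dE (s • g) g := by
  have h1 : ∫ w, S.f w (s * S.K g w) * S.K g w ∂m ≤
      ∫ w, s ^ (S.p ^ 2 - 1) * (S.f w (S.K g w) * S.K g w) ∂m :=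
    integral_mono (S.integrable_f_mul (s • S.K g) (S.K g))
      ((S.integrable_f_mul (S.K g) (S.K g)).const_mul _)
      fun w => comp_mul_mul_le_of_strictMonoOn (S.strictMono w) hs hs1.le _
  have h2 := hg.2
  have hA := S.norm_rpow_pos hg.1
  have hsp : 0 < s ^ S.p := Real.rpow_pos_of_pos hs _
  have hsp1 : 0 < s ^ (S.p - 1) := Real.rpow_pos_of_pos hs _
  have hlt : s ^ S.p < 1 := Real.rpow_lt_one hs.le hs1 S.p_pos
  rw [dE_self, sub_eq_zero] at h2
  rw [integral_const_mul, ← h2, S.rpow_exponent hs] at h1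
  rw [S.dE_smul_self hs]
  have h3 : (s ^ S.p * (S.a + S.b * ‖g‖ ^ S.p)) ^ (S.p - 1) <
      (S.a + S.b * (s ^ S.p * ‖g‖ ^ S.p)) ^ (S.p - 1) := by
    refine Real.rpow_lt_rpow (mul_pos hsp (S.base_pos g)).le ?_ (sub_pos.2 S.one_lt_p)
    nlinarith [S.a_pos]
  rw [Real.mul_rpow hsp.le (S.base_pos g).le] at h3
  have h4 := mul_lt_mul_of_pos_right h3 (mul_pos hsp1 hA)
  linarith

/-- For $s > 1$ both comparisons of `dE_smul_pos` are reversed. -/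
theorem dE_smul_neg {g : X} (hg : g ∈ S.N) {s : ℝ} (hs1 : 1 < s) : S.dE (s • g) g < 0 := by
  have hs : 0 < s := zero_lt_one.trans hs1
  have h1 : ∫ w, s ^ (S.p ^ 2 - 1) * (S.f w (S.K g w) * S.K g w) ∂m ≤
      ∫ w, S.f w (s * S.K g w) * S.K g w ∂m :=
    integral_mono ((S.integrable_f_mul (S.K g) (S.K g)).const_mul _)
      (S.integrable_f_mul (s • S.K g) (S.K g))
      fun w => le_comp_mul_mul_of_strictMonoOn (S.strictMono w) hs1.le _
  have h2 := hg.2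
  have hA := S.norm_rpow_pos hg.1
  have hsp : 0 < s ^ S.p := Real.rpow_pos_of_pos hs _
  have hsp1 : 0 < s ^ (S.p - 1) := Real.rpow_pos_of_pos hs _
  have hlt : 1 < s ^ S.p := Real.one_lt_rpow hs1 S.p_pos
  rw [dE_self, sub_eq_zero] at h2
  rw [integral_const_mul, ← h2, S.rpow_exponent hs] at h1
  rw [S.dE_smul_self hs]
  have h3 : (S.a + S.b * (s ^ S.p * ‖g‖ ^ S.p)) ^ (S.p - 1) <
      (s ^ S.p * (S.a + S.b * ‖g‖ ^ S.p)) ^ (S.p - 1) := by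
    refine Real.rpow_lt_rpow ?_ ?_ (sub_pos.2 S.one_lt_p)
    · have := S.a_pos; have := S.b_pos; positivity
    · nlinarith [S.a_pos]
  rw [Real.mul_rpow hsp.le (S.base_pos g).le] at h3
  have h4 := mul_lt_mul_of_pos_right h3 (mul_pos hsp1 hA)
  linarith

/-- A point of the Nehari manifold maximises the energy on its ray. -/
theorem E_smul_le {g : X} (hg : g ∈ S.N) {s : ℝ} (hs : 0 < s) : S.E (s • g) ≤ S.E g := by
  have hc : ContinuousOn (fun s : ℝ => S.E (s • g)) univ := fun s _ =>
    (S.hasDerivAt_E_smul g s).continuousAt.continuousWithinAt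
  rcases le_total s 1 with h | h
  · have hm : MonotoneOn (fun s : ℝ => S.E (s • g)) (Icc s 1) := by
      refine monotoneOn_of_deriv_nonneg (convex_Icc s 1) (hc.mono (subset_univ _))
        (fun s _ => (S.hasDerivAt_E_smul g s).differentiableAt.differentiableWithinAt)
        fun x hx => ?_
      rw [interior_Icc] at hx
      rw [(S.hasDerivAt_E_smul g x).deriv]
      exact (S.dE_smul_pos hg (hs.trans hx.1) hx.2).le
    simpa using hm (left_mem_Icc.2 h) (right_mem_Icc.2 h) h
  · have hm : AntitoneOn (fun s : ℝ => S.E (s • g)) (Icc 1 s) := by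
      refine antitoneOn_of_deriv_nonpos (convex_Icc 1 s) (hc.mono (subset_univ _))
        (fun s _ => (S.hasDerivAt_E_smul g s).differentiableAt.differentiableWithinAt)
        fun x hx => ?_
      rw [interior_Icc] at hx
      rw [(S.hasDerivAt_E_smul g x).deriv]
      exact (S.dE_smul_neg hg hx.1).le
    simpa using hm (left_mem_Icc.2 h) (right_mem_Icc.2 h) h

omit [BorelSpace Ω] in
/-- Near the origin the energy increases along rays. -/
theorem exists_dE_self_pos : ∃ ρ : ℝ, 0 < ρ ∧ ∀ g : X, g ≠ 0 → ‖g‖ < ρ → 0 < S.dE g g := by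
  have ha := Real.rpow_pos_of_pos S.a_pos (S.p - 1)
  -- `B` collects the operator norm of `K` and the total mass, each increased by one to stay
  -- positive. With $\varepsilon B = a^{p-1}/2$ the nonlinear term is at most half of the lower
  -- bound $a^{p-1}\|g\|^p$ for the Kirchhoff term.
  set B : ℝ := (‖S.K‖ + 1) ^ S.p * (m.real univ + 1) with hB
  have hK : 0 < ‖S.K‖ + 1 := by positivity
  have hm : 0 ≤ m.real univ := measureReal_nonneg
  have hBpos : 0 < B := mul_pos (Real.rpow_pos_of_pos hK _) (by linarith)
  set ε := S.a ^ (S.p - 1) / (2 * B) with hε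
  have hεpos : 0 < ε := by positivity
  obtain ⟨δ, hδ, hsmall⟩ := S.small ε hεpos
  refine ⟨δ / (‖S.K‖ + 1), by positivity, fun g hg hgδ => ?_⟩
  have hg0 := norm_pos_iff.2 hg
  have hKg : ‖S.K g‖ ≤ (‖S.K‖ + 1) * ‖g‖ :=
    (S.K.le_opNorm g).trans (mul_le_mul_of_nonneg_right (by linarith) (norm_nonneg g))
  have hlt : ‖S.K g‖ < δ := by
    rw [lt_div_iff₀ hK] at hgδ
    linarith
  have h1 := (le_abs_self _).trans (abs_integral_nemytskii_mul_le (m := m) (f := S.f) S.p_pos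
    hεpos.le (δ := δ) (fun w x hx => ?_) hlt)
  · rw [dE_self]
    have h2 : ‖S.K g‖ ^ S.p ≤ (‖S.K‖ + 1) ^ S.p * ‖g‖ ^ S.p := by
      rw [← Real.mul_rpow hK.le hg0.le]
      exact Real.rpow_le_rpow (norm_nonneg _) hKg S.p_pos.le
    have hA := S.norm_rpow_pos hg
    have h3 : ε * ‖S.K g‖ ^ S.p * m.real univ ≤ ε * B * ‖g‖ ^ S.p := by
      calc ε * ‖S.K g‖ ^ S.p * m.real univ
          ≤ ε * ((‖S.K‖ + 1) ^ S.p * ‖g‖ ^ S.p) * (m.real univ + 1) := by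
            gcongr; linarith
        _ = ε * B * ‖g‖ ^ S.p := by rw [hB]; ring
    have h4 : ε * B = S.a ^ (S.p - 1) / 2 := by rw [hε]; field_simp
    have h5 : S.a ^ (S.p - 1) ≤ (S.a + S.b * ‖g‖ ^ S.p) ^ (S.p - 1) :=
      Real.rpow_le_rpow S.a_pos.le (by nlinarith [S.b_pos]) (sub_pos.2 S.one_lt_p).le
    have h6 := mul_le_mul_of_nonneg_right h5 hA.le
    rw [h4] at h3
    have h7 := mul_pos ha hA
    linarith
  · rcases eq_or_ne x 0 with rfl | hx0
    · simp [Real.zero_rpow S.p_pos.ne']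
    · have h0 := abs_pos.2 hx0
      have h := mul_le_mul_of_nonneg_right (hsmall w x h0 hx) h0.le
      rwa [← abs_mul, mul_assoc, ← Real.rpow_add_one h0.ne', sub_add_cancel] at h

/-- For $s \ge 1$ the Kirchhoff term is at most a multiple of $s^{p^2}$, while the nonlinear term is
at least a positive multiple of $s^\mu$ minus a constant, and $\mu > p^2$. -/
theorem exists_dE_smul_neg {g : X} (hg : g ≠ 0) : ∃ s : ℝ, 1 ≤ s ∧ S.dE (s • g) (s • g) < 0 := by
  obtain ⟨μ, R, hμ, hR, hAR⟩ := S.superlinear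
  have hp2 : 0 < S.p ^ 2 := pow_pos S.p_pos 2
  have hμ0 : 0 < μ := hp2.trans hμ
  obtain ⟨c, C, hc, hcC⟩ := exists_rpow_sub_le S.continuous_f hμ0 hR hAR
  set u := S.K g with hu
  have hiu : Integrable (fun w => |u w| ^ μ) m :=
    ContinuousMap.integrable ⟨fun w => |u w| ^ μ,
      u.continuous.abs.rpow_const fun _ => Or.inr hμ0.le⟩
  set I := ∫ w, |u w| ^ μ ∂m with hI
  have hIpos : 0 < I := by
    have h0 : 0 ≤ I := integral_nonneg fun w => Real.rpow_nonneg (abs_nonneg _) _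
    refine h0.lt_of_ne fun h => hg (S.injective g ?_)
    rw [eq_comm, hI, integral_eq_zero_iff_of_nonneg
      (fun w => Real.rpow_nonneg (abs_nonneg _) _) hiu] at h
    filter_upwards [h] with w hw
    have hw' : |u w| ^ μ = 0 := hw
    rwa [Real.rpow_eq_zero (abs_nonneg _) hμ0.ne', abs_eq_zero] at hw'
  set A := ‖g‖ ^ S.p with hA
  have hApos : 0 < A := S.norm_rpow_pos hg
  set B := (S.a + S.b * A) ^ (S.p - 1) * A with hB
  set M := max C 0 * m.real univ with hM
  have hm : 0 ≤ m.real univ := measureReal_nonneg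
  have hM0 : 0 ≤ M := mul_nonneg (le_max_right _ _) hm
  -- Multiplied by $s^{p^2} \ge 1$, this threshold beats the Kirchhoff bound $s^{p^2}B$ and the
  -- constant loss $M$, with $s^{p^2}$ to spare.
  have ht := ((tendsto_rpow_atTop (sub_pos.2 hμ)).const_mul_atTop
    (mul_pos hc hIpos)).eventually_ge_atTop (B + M + 1)
  obtain ⟨s, hs, hs1⟩ := (ht.and (eventually_ge_atTop 1)).exists
  refine ⟨s, hs1, ?_⟩
  have hs0 : 0 < s := by linarith
  rw [dE_smul, S.dE_smul_self hs0, mul_sub, ← integral_const_mul]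
  have h1 : c * s ^ μ * I - M ≤ ∫ w, s * (S.f w (s * u w) * u w) ∂m := by
    have : ∫ w, (c * s ^ μ * |u w| ^ μ - max C 0) ∂m ≤ ∫ w, s * (S.f w (s * u w) * u w) ∂m := by
      refine integral_mono ((hiu.const_mul _).sub (integrable_const _))
        ((S.integrable_f_mul (s • u) u).const_mul s) fun w => ?_
      have h := hcC w (s * u w)
      rw [abs_mul, abs_of_pos hs0, Real.mul_rpow hs0.le (abs_nonneg _)] at h
      have := le_max_left C 0
      simp only
      linarith
    rwa [integral_sub (hiu.const_mul _) (integrable_const _), integral_const_mul, integral_const,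
      smul_eq_mul, mul_comm (m.real univ)] at this
  have hsp : 1 ≤ s ^ S.p := Real.one_le_rpow hs1 S.p_pos.le
  have h2 : (S.a + S.b * (s ^ S.p * A)) ^ (S.p - 1) ≤
      (s ^ S.p) ^ (S.p - 1) * (S.a + S.b * A) ^ (S.p - 1) := by
    rw [← Real.mul_rpow (by linarith) (S.base_pos g).le]
    refine Real.rpow_le_rpow ?_ ?_ (sub_pos.2 S.one_lt_p).le
    · have := S.a_pos; have := S.b_pos; positivity
    · nlinarith [S.a_pos]
  have hs2 : s * ((s ^ S.p) ^ (S.p - 1) * s ^ (S.p - 1)) = s ^ S.p ^ 2 := by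
    rw [← S.rpow_exponent hs0, Real.rpow_sub_one hs0.ne', mul_div_cancel₀ _ hs0.ne']
  have h3 : s * ((S.a + S.b * (s ^ S.p * A)) ^ (S.p - 1) * (s ^ (S.p - 1) * A)) ≤
      s ^ (S.p ^ 2) * B := by
    rw [← hs2, hB]
    have h4 : 0 ≤ s * (s ^ (S.p - 1) * A) := by positivity
    nlinarith [mul_le_mul_of_nonneg_right h2 h4]
  have h5 : s ^ μ = s ^ (S.p ^ 2) * s ^ (μ - S.p ^ 2) := by
    rw [← Real.rpow_add hs0]; ring_nf
  have h6 : 1 ≤ s ^ (S.p ^ 2) := Real.one_le_rpow hs1 hp2.le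
  have h7 : s ^ (S.p ^ 2) * (B + M + 1) ≤ c * s ^ μ * I := by
    rw [h5]
    nlinarith [mul_le_mul_of_nonneg_left hs (zero_le_one.trans h6)]
  nlinarith [mul_le_mul_of_nonneg_right h6 hM0]

theorem exists_smul_mem_N [T2Space Ω] {g : X} (hg : g ≠ 0) : ∃ s : ℝ, 0 < s ∧ s • g ∈ S.N := by
  obtain ⟨s₁, hs₁, hneg⟩ := S.exists_dE_smul_neg hg
  obtain ⟨ρ, hρ, hpos⟩ := S.exists_dE_self_pos
  have hg0 := norm_pos_iff.2 hg
  -- The minimum with $1$ ensures $s_0 \le s_1$ for the intermediate value theorem.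
  set s₀ := min (ρ / (2 * ‖g‖)) 1 with hs₀
  have hs₀pos : 0 < s₀ := lt_min (by positivity) one_pos
  have h0 : 0 < S.dE (s₀ • g) (s₀ • g) := by
    refine hpos _ (smul_ne_zero hs₀pos.ne' hg) ?_
    rw [norm_smul, Real.norm_of_nonneg hs₀pos.le]
    calc s₀ * ‖g‖ ≤ ρ / (2 * ‖g‖) * ‖g‖ := by gcongr; exact min_le_left _ _
      _ = ρ / 2 := by field_simp
      _ < ρ := by linarith
  rw [dE_smul] at h0 hneg
  have h0' : 0 < S.dE (s₀ • g) g := pos_of_mul_pos_right h0 hs₀pos.le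
  have h1' : S.dE (s₁ • g) g < 0 := neg_of_mul_neg_right hneg (by linarith)
  obtain ⟨s, hs, hs'⟩ := intermediate_value_Icc' ((min_le_right _ _).trans hs₁)
    (S.continuous_dE_smul g g).continuousOn ⟨h1'.le, h0'.le⟩
  have hspos : 0 < s := hs₀pos.trans_le hs.1
  refine ⟨s, hspos, smul_ne_zero hspos.ne' hg, ?_⟩
  exact (S.dE_smul _ _ _).trans (by rw [show S.dE (s • g) g = 0 from hs', mul_zero])

/-- Since $\langle I'(g), g\rangle = 0$, subtracting $p^{-2}$ times it costs nothing. It cancels the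
$b$-part of the Kirchhoff energy, and the remaining nonlinear part is nonnegative because $p^2F \le
xf$. The bound is nonnegative and tends to infinity with $\|g\|$. -/
theorem le_E_of_mem_N {g : X} (hg : g ∈ S.N) :
    S.a / (S.b * S.p ^ 2) * ((S.a + S.b * ‖g‖ ^ S.p) ^ (S.p - 1) - S.a ^ (S.p - 1)) ≤ S.E g := by
  have hb := S.b_pos
  have hp := S.p_pos
  have h1 : S.p ^ 2 * ∫ w, primOn S.f w (S.K g w) ∂m ≤ ∫ w, S.f w (S.K g w) * S.K g w ∂m := by
    rw [← integral_const_mul]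
    refine integral_mono ((S.integrable_primOn _).const_mul _) (S.integrable_f_mul _ _) fun w => ?_
    have hfw : Continuous (S.f w) :=
      S.continuous_f.comp (by fun_prop : Continuous fun x : ℝ => (w, x))
    have := mul_integral_le_of_strictMonoOn hfw S.exponent_pos (S.strictMono w) (S.K g w)
    rw [sub_add_cancel] at this
    simp only [primOn]
    linarith
  have h2 := hg.2
  rw [dE_self, sub_eq_zero] at h2
  rw [← h2] at h1
  have e1 : (S.a + S.b * ‖g‖ ^ S.p) ^ S.p =
      (S.a + S.b * ‖g‖ ^ S.p) ^ (S.p - 1) * (S.a + S.b * ‖g‖ ^ S.p) := by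
    rw [← Real.rpow_add_one (S.base_pos g).ne', sub_add_cancel]
  have e2 : S.a ^ S.p = S.a ^ (S.p - 1) * S.a := by
    rw [← Real.rpow_add_one S.a_pos.ne', sub_add_cancel]
  rw [E, e1, e2]
  set q := (S.a + S.b * ‖g‖ ^ S.p) ^ (S.p - 1)
  set P := ∫ w, primOn S.f w (S.K g w) ∂m
  have e3 : 1 / (S.b * S.p ^ 2) * (q * (S.a + S.b * ‖g‖ ^ S.p)) - P -
      S.a ^ (S.p - 1) * S.a / (S.b * S.p ^ 2) =
      S.a / (S.b * S.p ^ 2) * (q - S.a ^ (S.p - 1)) + (q * ‖g‖ ^ S.p - S.p ^ 2 * P) / S.p ^ 2 := by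
    field_simp
    ring
  rw [e3]
  have : 0 ≤ (q * ‖g‖ ^ S.p - S.p ^ 2 * P) / S.p ^ 2 := div_nonneg (by linarith) (by positivity)
  linarith

theorem E_nonneg_of_mem_N {g : X} (hg : g ∈ S.N) : 0 ≤ S.E g := by
  refine le_trans (mul_nonneg ?_ (sub_nonneg.2 ?_)) (S.le_E_of_mem_N hg)
  · have := S.a_pos; have := S.b_pos; have := S.p_pos; positivity
  · refine Real.rpow_le_rpow S.a_pos.le ?_ (sub_pos.2 S.one_lt_p).le
    have := mul_nonneg S.b_pos.le (Real.rpow_nonneg (norm_nonneg g) S.p)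
    linarith

/-- The energy is coercive on the Nehari manifold. -/
theorem exists_norm_le_of_mem_N (M : ℝ) : ∃ B : ℝ, ∀ g ∈ S.N, S.E g ≤ M → ‖g‖ ≤ B := by
  have ha := S.a_pos
  have hb := S.b_pos
  have hp := S.p_pos
  have hp1 := sub_pos.2 S.one_lt_p
  have hc : 0 < S.a / (S.b * S.p ^ 2) := by positivity
  have ht : Tendsto (fun x : ℝ => S.a / (S.b * S.p ^ 2) *
      ((S.a + S.b * x ^ S.p) ^ (S.p - 1) - S.a ^ (S.p - 1))) atTop atTop := by
    refine Tendsto.const_mul_atTop hc (tendsto_atTop_add_const_right _ _ ?_)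
    exact (tendsto_rpow_atTop hp1).comp (tendsto_atTop_add_const_left _ _
      ((tendsto_rpow_atTop hp).const_mul_atTop hb))
  obtain ⟨B, hB⟩ := (ht.eventually_gt_atTop M).exists_forall_of_atTop
  refine ⟨B, fun g hg hgM => ?_⟩
  by_contra! h
  exact absurd ((S.le_E_of_mem_N hg).trans hgM) (not_le.2 (hB _ h.le))

/-- The energy attains its minimum on the Nehari manifold. -/
theorem exists_isMinOn_N [T2Space Ω] [CompleteSpace X] [UniformConvexSpace X] [Nontrivial X] :
    ∃ g ∈ S.N, ∀ k ∈ S.N, S.E g ≤ S.E k := by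
  have ha := S.a_pos
  have hb := S.b_pos
  have hp := S.p_pos
  have hp1 := sub_pos.2 S.one_lt_p
  obtain ⟨x, hx⟩ := exists_ne (0 : X)
  obtain ⟨s, -, hsN⟩ := S.exists_smul_mem_N hx
  have hne : (S.E '' S.N).Nonempty := ⟨_, _, hsN, rfl⟩
  have hbd : BddBelow (S.E '' S.N) :=
    ⟨0, by rintro _ ⟨g, hg, rfl⟩; exact S.E_nonneg_of_mem_N hg⟩
  obtain ⟨e, -, he, heN⟩ := exists_seq_tendsto_sInf hne hbd
  choose g hgN hge using heN
  obtain ⟨M, hM⟩ := he.bddAbove_range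
  obtain ⟨B, hB⟩ := S.exists_norm_le_of_mem_N M
  have hgB : ∀ n, ‖g n‖ ≤ B := fun n => hB _ (hgN n) (by
    rw [hge n]; exact hM ⟨n, rfl⟩)
  -- Images under `K` and norms are taken together, so one subsequence makes both converge.
  have hcomp : IsCompact (closure (S.K '' Metric.closedBall 0 B) ×ˢ Icc 0 B) :=
    (S.compact.isCompact_closure_image_closedBall B).prod isCompact_Icc
  obtain ⟨⟨u, L⟩, -, φ, hφ, hlim⟩ := hcomp.tendsto_subseq (x := fun n => (S.K (g n), ‖g n‖))
    fun n => ⟨subset_closure ⟨_, by simpa using hgB n, rfl⟩, norm_nonneg _, hgB n⟩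
  have hu : Tendsto (fun n => S.K (g (φ n))) atTop (𝓝 u) :=
    (continuous_fst.tendsto _).comp hlim
  have hL : Tendsto (fun n => ‖g (φ n)‖) atTop (𝓝 L) := (continuous_snd.tendsto _).comp hlim
  obtain ⟨g₀, hKg, hgL⟩ := UniformConvexSpace.exists_map_eq_of_tendsto S.K hu hL
  have hcont : Continuous fun x : ℝ => (S.a + S.b * x ^ S.p) := by
    have : Continuous fun x : ℝ => x ^ S.p := continuous_id.rpow_const fun _ => Or.inr hp.le
    fun_prop
  -- The manifold stays at distance at least $\rho$ from $0$, so $\int f(Kg_n)Kg_n$ is bounded below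
  -- by a positive constant. This passes to the limit, where $Kg_0 = 0$ would make the integral
  -- vanish.
  have hg₀ : g₀ ≠ 0 := by
    rintro rfl
    obtain ⟨ρ, hρ, hpos⟩ := S.exists_dE_self_pos
    have hρn : ∀ n, ρ ≤ ‖g n‖ := fun n => by
      by_contra! h
      exact (hpos _ (hgN n).1 h).ne' (hgN n).2
    have h1 : ∀ n, S.a ^ (S.p - 1) * ρ ^ S.p ≤ ∫ w, S.f w (S.K (g n) w) * S.K (g n) w ∂m :=
      fun n => by
        have h := (hgN n).2
        rw [dE_self, sub_eq_zero] at h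
        rw [← h]
        have h2 : ρ ^ S.p ≤ ‖g n‖ ^ S.p := Real.rpow_le_rpow hρ.le (hρn n) hp.le
        have h3 : S.a ^ (S.p - 1) ≤ (S.a + S.b * ‖g n‖ ^ S.p) ^ (S.p - 1) := by
          refine Real.rpow_le_rpow ha.le ?_ hp1.le
          have := mul_nonneg hb.le (Real.rpow_nonneg (norm_nonneg (g n)) S.p)
          linarith
        exact mul_le_mul h3 h2 (Real.rpow_nonneg hρ.le _) (Real.rpow_nonneg (S.base_pos _).le _)
    have h2 : Tendsto (fun n => ∫ w, S.f w (S.K (g (φ n)) w) * S.K (g (φ n)) w ∂m) atTop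
        (𝓝 (∫ w, S.f w (u w) * u w ∂m)) :=
      ((continuous_integral_nemytskii_mul S.continuous_f).tendsto (u, u)).comp (hu.prodMk_nhds hu)
    have h3 := ge_of_tendsto h2 (Eventually.of_forall fun n => h1 (φ n))
    rw [← hKg] at h3
    simp only [map_zero, ContinuousMap.zero_apply, mul_zero, integral_zero] at h3
    have : 0 < S.a ^ (S.p - 1) * ρ ^ S.p :=
      mul_pos (Real.rpow_pos_of_pos ha _) (Real.rpow_pos_of_pos hρ _)
    linarith
  obtain ⟨t, ht, htN⟩ := S.exists_smul_mem_N hg₀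
  refine ⟨t • g₀, htN, fun k hk => le_trans ?_ (csInf_le hbd ⟨k, hk, rfl⟩)⟩
  have hEn : Tendsto (fun n => S.E (g (φ n))) atTop (𝓝 (sInf (S.E '' S.N))) := by
    simp only [hge]
    exact he.comp hφ.tendsto_atTop
  have hlimE : Tendsto (fun n => S.E (t • g (φ n))) atTop
      (𝓝 (1 / (S.b * S.p ^ 2) * (S.a + S.b * (t * L) ^ S.p) ^ S.p -
        (∫ w, primOn S.f w ((t • u) w) ∂m) - S.a ^ S.p / (S.b * S.p ^ 2))) := by
    have h1 : Tendsto (fun n => ‖t • g (φ n)‖) atTop (𝓝 (t * L)) := by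
      simp only [norm_smul, Real.norm_of_nonneg ht.le]
      exact hL.const_mul t
    have h2 : Tendsto (fun n => S.K (t • g (φ n))) atTop (𝓝 (t • u)) := by
      simp only [map_smul]
      exact hu.const_smul t
    have h3 := ((hcont.rpow_const fun _ => Or.inr hp.le).tendsto (t * L)).comp h1
    have h4 := ((continuous_integral_nemytskii (m := m)
      (continuous_primOn S.continuous_f)).tendsto (t • u)).comp h2
    exact ((h3.const_mul _).sub h4).sub_const _
  -- Each $g_n$ maximises the energy on its own ray, so the common factor $t$ does not raise the
  -- energy. The remaining comparison uses only $\|g_0\| \le L$ and the monotonicity of the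
  -- Kirchhoff term.
  refine le_trans ?_ (le_of_tendsto_of_tendsto' hlimE hEn fun n => S.E_smul_le (hgN (φ n)) ht)
  rw [E, map_smul, hKg, norm_smul, Real.norm_of_nonneg ht.le]
  gcongr

/-- A minimiser of the energy on the Nehari manifold is a critical point. -/
theorem dE_eq_zero_of_isMinOn_N [T2Space Ω] {g : X} (hg : g ∈ S.N)
    (hmin : ∀ k ∈ S.N, S.E g ≤ S.E k) (k : X) : S.dE g k = 0 := by
  -- Applied to $k$ and $-k$, the absence of descent directions gives a critical point.
  suffices h : ∀ k, ¬ S.dE g k < 0 by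
    have h1 := h k
    have h2 := h ((-1 : ℝ) • k)
    rw [dE_smul] at h2
    linarith
  intro k hk
  have hc := (S.continuous_dE_comb g k k).continuousAt (x := ((1 : ℝ), (0 : ℝ)))
  have hev : ∀ᶠ z : ℝ × ℝ in 𝓝 (1, 0), S.dE (z.1 • g + z.2 • k) k < 0 :=
    hc.eventually_lt continuousAt_const (by simpa using hk)
  obtain ⟨η', hη', hball⟩ := Metric.eventually_nhds_iff.1 hev
  -- Half of `η'` stays strictly inside the neighbourhood where `k` is a descent direction; the
  -- bound $1/2$ keeps $1 - \eta$ positive.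
  set η := min (η' / 2) (1 / 2) with hη
  have hη0 : 0 < η := lt_min (by linarith) (by norm_num)
  have hη1 : η < 1 := (min_le_right _ _).trans_lt (by norm_num)
  have hηη : η < η' := (min_le_left _ _).trans_lt (by linarith)
  have hneg : ∀ s e : ℝ, |s - 1| ≤ η → |e| ≤ η → S.dE (s • g + e • k) k < 0 := fun s e hs he => by
    refine hball (y := (s, e)) ?_
    rw [Prod.dist_eq, max_lt_iff, Real.dist_eq, Real.dist_eq, sub_zero]
    exact ⟨hs.trans_lt hηη, he.trans_lt hηη⟩
  have hself := S.continuous_dE_comb_self g k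
  have hs1 : 0 < 1 - η := by linarith
  have e1 : ∀ᶠ e in 𝓝[>] (0 : ℝ), 0 < S.dE ((1 - η) • g + e • k) ((1 - η) • g + e • k) := by
    refine nhdsWithin_le_nhds (continuousAt_const.eventually_lt
      (hself.comp (by fun_prop : Continuous fun e : ℝ => (1 - η, e))).continuousAt ?_)
    simp only [zero_smul, add_zero, dE_smul]
    exact mul_pos hs1 (S.dE_smul_pos hg hs1 (by linarith))
  have e2 : ∀ᶠ e in 𝓝[>] (0 : ℝ), S.dE ((1 + η) • g + e • k) ((1 + η) • g + e • k) < 0 := by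
    refine nhdsWithin_le_nhds ((hself.comp
      (by fun_prop : Continuous fun e : ℝ => (1 + η, e))).continuousAt.eventually_lt
      continuousAt_const ?_)
    simp only [Function.comp_apply, zero_smul, add_zero, dE_smul]
    exact mul_neg_of_pos_of_neg (by linarith) (S.dE_smul_neg hg (by linarith))
  obtain ⟨e, he1, he2, he0, heη⟩ := (e1.and (e2.and (Ioo_mem_nhdsGT hη0))).exists
  -- The signs of $\langle I', \cdot\rangle$ on the ray at $1 \pm \eta$ survive the small shift by
  -- $ek$, so the shifted segment crosses the Nehari condition.
  obtain ⟨s, hs, hs'⟩ := intermediate_value_Icc' (by linarith : 1 - η ≤ 1 + η)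
    (hself.comp (by fun_prop : Continuous fun s : ℝ => (s, e))).continuousOn ⟨he2.le, he1.le⟩
  simp only [Function.comp_apply] at hs'
  have hsη : |s - 1| ≤ η := abs_le.2 ⟨by linarith [hs.1], by linarith [hs.2]⟩
  have hmem : s • g + e • k ∈ S.N := by
    refine ⟨fun h0 => ?_, hs'⟩
    -- The crossing point is nonzero: otherwise $0 = \langle I'(g), sg + ek\rangle = e\langle I'(g),
    -- k\rangle < 0$.
    have h1 : S.dE g (s • g + e • k) = e * S.dE g k := by
      rw [dE_add, dE_smul, dE_smul, hg.2, mul_zero, zero_add]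
    have h2 : S.dE g (0 : X) = 0 := by
      simpa using S.dE_smul g 0 0
    rw [h0, h2] at h1
    exact (mul_neg_of_pos_of_neg he0 hk).ne h1.symm
  have hanti : StrictAntiOn (fun y : ℝ => S.E (s • g + y • k)) (Icc 0 e) := by
    refine strictAntiOn_of_deriv_neg (convex_Icc 0 e)
      (fun y _ => (S.hasDerivAt_E (s • g) k y).continuousAt.continuousWithinAt) fun y hy => ?_
    rw [interior_Icc] at hy
    rw [(S.hasDerivAt_E (s • g) k y).deriv]
    exact hneg s y hsη (abs_le.2 ⟨by linarith [hy.1], by linarith [hy.2]⟩)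
  have h1 := hanti (left_mem_Icc.2 he0.le) (right_mem_Icc.2 he0.le) he0
  simp only [zero_smul, add_zero] at h1
  have h2 := S.E_smul_le hg (hs1.trans_le hs.1)
  exact absurd (hmin _ hmem) (not_le.2 (h1.trans_le h2))

end KirchhoffData

end FracKirchhoff

/-! ### Riemann–Liouville integrals: semigroup property and inversion. -/

namespace FracKirchhoff

/-- The convolution kernel of the left Riemann–Liouville integral. -/
noncomputable def rlKernel (γ x : ℝ) : ℝ := if 0 < x then x ^ (γ - 1) / Real.Gamma γ else 0

theorem measurable_rlKernel (γ : ℝ) : Measurable (rlKernel γ) :=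
  Measurable.ite measurableSet_Ioi (by fun_prop) measurable_const

theorem rlKernel_nonneg {γ : ℝ} (hγ : 0 < γ) (x : ℝ) : 0 ≤ rlKernel γ x := by
  unfold rlKernel
  split_ifs with h
  · exact div_nonneg (Real.rpow_nonneg h.le _) (Real.Gamma_pos_of_pos hγ).le
  · exact le_rfl

theorem rlKernel_of_nonpos {γ x : ℝ} (hx : x ≤ 0) : rlKernel γ x = 0 := if_neg hx.not_gt

theorem rlKernel_mul {γ c : ℝ} (hc : 0 < c) (x : ℝ) :
    rlKernel γ (c * x) = c ^ (γ - 1) * rlKernel γ x := by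
  unfold rlKernel
  simp only [mul_pos_iff_of_pos_left hc]
  split_ifs with h
  · rw [Real.mul_rpow hc.le h.le, mul_div_assoc]
  · simp

instance (T : ℝ) : IsFiniteMeasure (vol T) := by unfold vol; infer_instance

theorem setIntegral_eq_intervalIntegral_vol {T t : ℝ} (ht : t ∈ Icc 0 T) (g : ℝ → ℝ) :
    ∫ s, (Iio t).indicator g s ∂(vol T) = ∫ s in (0 : ℝ)..t, g s := by
  rw [intervalIntegral.integral_of_le ht.1, integral_Ioc_eq_integral_Ioo, vol,
    setIntegral_indicator measurableSet_Iio]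
  congr 2
  ext s
  simp only [mem_inter_iff, mem_Ioc, mem_Iio, mem_Ioo]
  exact ⟨fun h => ⟨h.1.1, h.2⟩, fun h => ⟨⟨h.1, h.2.le.trans ht.2⟩, h.2⟩⟩

/-- With a kernel that vanishes on $(-\infty, 0]$ the domain of integration no longer depends on
$t$, as Fubini and the comparison of two values of $t$ require. -/
theorem rlIntegral_eq {γ T t : ℝ} (ht : t ∈ Icc 0 T) (g : ℝ → ℝ) :
    rlIntegral γ g t = ∫ s, rlKernel γ (t - s) * g s ∂(vol T) := by
  rw [rlIntegral, ← intervalIntegral.integral_const_mul, ← setIntegral_eq_intervalIntegral_vol ht]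
  refine integral_congr_ae (Eventually.of_forall fun s => ?_)
  by_cases h : s < t
  · simp only [indicator, mem_Iio, h, if_true, rlKernel, sub_pos]
    ring
  · simp [indicator, rlKernel, sub_pos, h]

theorem rlIntegral_congr {γ T t : ℝ} (ht : t ∈ Icc 0 T) {g h : ℝ → ℝ} (hgh : g =ᵐ[vol T] h) :
    rlIntegral γ g t = rlIntegral γ h t := by
  rw [rlIntegral_eq ht, rlIntegral_eq ht]
  refine integral_congr_ae ?_
  filter_upwards [hgh] with s hs
  rw [hs]

section Beta

variable {x y : ℝ}

/-- As $\Gamma(x+y) = \Gamma(1) = 1$, the product of the two Gamma factors is exactly the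
normalisation of the Beta density, whose total mass is known to be one. -/
theorem rlKernel_mul_rlKernel_one_sub (hxy : x + y = 1) (z : ℝ) :
    rlKernel x (1 - z) * rlKernel y z = ProbabilityTheory.betaPDFReal y x z := by
  unfold rlKernel ProbabilityTheory.betaPDFReal
  have hb : ProbabilityTheory.beta y x = Real.Gamma y * Real.Gamma x := by
    rw [ProbabilityTheory.beta, add_comm y x, hxy, Real.Gamma_one, div_one]
  rw [hb]
  by_cases h0 : 0 < z <;> by_cases h1 : z < 1 <;> simp [h0, h1]
  ring

/-- For $r < t$, translation by $r$ and scaling by $c = t - r$ lead to the Beta density; the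
Jacobian $c$ cancels $c^{x-1}c^{y-1} = c^{-1}$. Otherwise the supports of the factors do not meet.
-/
theorem lintegral_rlKernel (hx : 0 < x) (hy : 0 < y) (hxy : x + y = 1) (t r : ℝ) :
    ∫⁻ s, ENNReal.ofReal (rlKernel x (t - s) * rlKernel y (s - r)) = if r < t then 1 else 0 := by
  split_ifs with h
  · set c := t - r with hc
    have hc0 : 0 < c := sub_pos.2 h
    have hmeas : Measurable fun z : ℝ => ENNReal.ofReal (rlKernel x (c - z) * rlKernel y z) :=
      (((measurable_rlKernel x).comp (measurable_const.sub measurable_id)).mul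
        (measurable_rlKernel y)).ennreal_ofReal
    have h1 : ∫⁻ s, ENNReal.ofReal (rlKernel x (t - s) * rlKernel y (s - r)) =
        ∫⁻ z, ENNReal.ofReal (rlKernel x (c - z) * rlKernel y z) := by
      rw [← lintegral_add_right_eq_self _ r]
      simp only [hc, add_sub_cancel_left, sub_sub, add_comm]
    have h2 : ∀ z, ENNReal.ofReal (rlKernel x (c - c * z) * rlKernel y (c * z)) =
        ENNReal.ofReal c⁻¹ * ProbabilityTheory.betaPDF y x z := fun z => by
      rw [ProbabilityTheory.betaPDF, ← ENNReal.ofReal_mul (inv_pos.2 hc0).le,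
        ← rlKernel_mul_rlKernel_one_sub hxy, ← mul_one_sub, rlKernel_mul hc0, rlKernel_mul hc0]
      congr 1
      have : c ^ (x - 1) * c ^ (y - 1) = c⁻¹ := by
        rw [← Real.rpow_add hc0, ← Real.rpow_neg_one]
        congr 1
        linarith
      rw [← this]
      ring
    rw [h1, ← Real.smul_map_volume_mul_left hc0.ne', lintegral_smul_measure,
      lintegral_map hmeas (measurable_const_mul c)]
    simp only [h2]
    rw [lintegral_const_mul' _ _ ENNReal.ofReal_ne_top,
      ProbabilityTheory.lintegral_betaPDF_eq_one hy hx, mul_one, abs_of_pos hc0, smul_eq_mul,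
      ← ENNReal.ofReal_mul hc0.le, mul_inv_cancel₀ hc0.ne', ENNReal.ofReal_one]
  · rw [lintegral_eq_zero_iff' ?_]
    · refine Eventually.of_forall fun s => ?_
      rcases le_total s r with hs | hs
      · simp [rlKernel_of_nonpos (sub_nonpos.2 hs)]
      · simp [rlKernel_of_nonpos (sub_nonpos.2 ((not_lt.1 h).trans hs))]
    · exact ((((measurable_rlKernel x).comp (measurable_const.sub measurable_id)).mul
        ((measurable_rlKernel y).comp (measurable_id.sub_const r))).ennreal_ofReal).aemeasurable

theorem lintegral_vol_rlKernel (hx : 0 < x) (hy : 0 < y) (hxy : x + y = 1) {T t r : ℝ}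
    (ht : t ≤ T) (hr : 0 ≤ r) :
    ∫⁻ s, ENNReal.ofReal (rlKernel x (t - s) * rlKernel y (s - r)) ∂(vol T) =
      if r < t then 1 else 0 := by
  rw [← lintegral_rlKernel hx hy hxy t r, vol, setLIntegral_eq_of_support_subset]
  intro s hs
  rw [Function.mem_support] at hs
  by_contra h
  refine hs ?_
  rw [mem_Ioc, not_and_or, not_lt, not_le] at h
  rcases h with h | h
  · simp [rlKernel_of_nonpos (sub_nonpos.2 (h.trans hr))]
  · simp [rlKernel_of_nonpos (sub_nonpos.2 (ht.trans h.le))]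

theorem integral_vol_rlKernel (hx : 0 < x) (hy : 0 < y) (hxy : x + y = 1) {T t r : ℝ}
    (ht : t ≤ T) (hr : 0 ≤ r) :
    ∫ s, rlKernel x (t - s) * rlKernel y (s - r) ∂(vol T) = if r < t then 1 else 0 := by
  rw [integral_eq_lintegral_of_nonneg_ae
    (Eventually.of_forall fun s => mul_nonneg (rlKernel_nonneg hx _) (rlKernel_nonneg hy _)),
    lintegral_vol_rlKernel hx hy hxy ht hr]
  · split_ifs <;> simp
  · exact (((measurable_rlKernel x).comp (measurable_const.sub measurable_id)).mul
        ((measurable_rlKernel y).comp (measurable_id.sub_const r))).aestronglyMeasurable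

theorem ae_vol_mem (T : ℝ) : ∀ᵐ t ∂(vol T), t ∈ Ioc 0 T := ae_restrict_mem measurableSet_Ioc

/-- The semigroup property `I^x I^y = I^1` for `x + y = 1`. -/
theorem rlIntegral_rlIntegral (hx : 0 < x) (hy : 0 < y) (hxy : x + y = 1) {T t : ℝ}
    (ht : t ∈ Icc 0 T) {g : ℝ → ℝ} (hg : Integrable g (vol T)) :
    rlIntegral x (rlIntegral y g) t = ∫ s in (0 : ℝ)..t, g s := by
  have hmk : Measurable fun z : ℝ × ℝ => rlKernel x (t - z.1) * rlKernel y (z.1 - z.2) :=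
    ((measurable_rlKernel x).comp (measurable_const.sub measurable_fst)).mul
      ((measurable_rlKernel y).comp (measurable_fst.sub measurable_snd))
  have hmeas : AEStronglyMeasurable
      (fun z : ℝ × ℝ => rlKernel x (t - z.1) * rlKernel y (z.1 - z.2) * g z.2)
      ((vol T).prod (vol T)) :=
    hmk.aestronglyMeasurable.mul hg.1.comp_snd
  -- By Tonelli the inner integral of the kernels is at most one, so the double integral is
  -- dominated by the $L^1$ norm of `g`.
  have hint : Integrable (fun z : ℝ × ℝ =>
      rlKernel x (t - z.1) * rlKernel y (z.1 - z.2) * g z.2) ((vol T).prod (vol T)) := by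
    refine ⟨hmeas, ?_⟩
    rw [hasFiniteIntegral_iff_enorm, lintegral_prod_symm _ hmeas.enorm]
    have hle : ∫⁻ r, ∫⁻ s, ‖rlKernel x (t - s) * rlKernel y (s - r) * g r‖ₑ ∂(vol T) ∂(vol T) ≤
        ∫⁻ r, ‖g r‖ₑ ∂(vol T) := by
      refine lintegral_mono_ae ?_
      filter_upwards [ae_vol_mem T] with r hr
      have : ∀ s, ‖rlKernel x (t - s) * rlKernel y (s - r) * g r‖ₑ =
          ENNReal.ofReal (rlKernel x (t - s) * rlKernel y (s - r)) * ‖g r‖ₑ := fun s => by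
        rw [enorm_mul, Real.enorm_of_nonneg
          (mul_nonneg (rlKernel_nonneg hx _) (rlKernel_nonneg hy _))]
      simp only [this]
      rw [lintegral_mul_const' _ _ enorm_ne_top, lintegral_vol_rlKernel hx hy hxy ht.2 hr.1.le]
      split_ifs <;> simp
    exact hle.trans_lt hg.2
  rw [rlIntegral_eq ht]
  calc ∫ s, rlKernel x (t - s) * rlIntegral y g s ∂(vol T)
      = ∫ s, ∫ r, rlKernel x (t - s) * rlKernel y (s - r) * g r ∂(vol T) ∂(vol T) := by
        refine integral_congr_ae ?_
        filter_upwards [ae_vol_mem T] with s hs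
        rw [rlIntegral_eq ⟨hs.1.le, hs.2⟩, ← integral_const_mul]
        simp only [mul_assoc]
    _ = ∫ r, ∫ s, rlKernel x (t - s) * rlKernel y (s - r) * g r ∂(vol T) ∂(vol T) :=
        integral_integral_swap hint
    _ = ∫ r, (Iio t).indicator g r ∂(vol T) := by
        refine integral_congr_ae ?_
        filter_upwards [ae_vol_mem T] with r hr
        rw [integral_mul_const, integral_vol_rlKernel hx hy hxy ht.2 hr.1.le]
        by_cases h : r < t <;> simp [h]
    _ = ∫ s in (0 : ℝ)..t, g s := setIntegral_eq_intervalIntegral_vol ht g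

theorem rlIntegral_one (g : ℝ → ℝ) (t : ℝ) : rlIntegral 1 g t = ∫ s in (0 : ℝ)..t, g s := by
  simp [rlIntegral]

theorem integrable_vol_iff {T : ℝ} (hT : 0 ≤ T) {g : ℝ → ℝ} :
    Integrable g (vol T) ↔ IntervalIntegrable g volume 0 T :=
  (intervalIntegrable_iff_integrableOn_Ioc_of_le hT).symm

theorem ae_vol_mem_Ioo (T : ℝ) : ∀ᵐ t ∂(vol T), t ∈ Ioo 0 T := by
  rw [vol, ← restrict_Ioo_eq_restrict_Ioc]
  exact ae_restrict_mem measurableSet_Ioo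

theorem ae_vol_hasDerivAt {T : ℝ} (hT : 0 ≤ T) {g : ℝ → ℝ} (hg : Integrable g (vol T)) :
    ∀ᵐ t ∂(vol T), HasDerivAt (fun t => ∫ s in (0 : ℝ)..t, g s) (g t) t := by
  have h := ((integrable_vol_iff hT).1 hg).ae_hasDerivAt_integral
  filter_upwards [ae_restrict_of_ae (s := Ioc 0 T) h, ae_vol_mem T] with t h1 h2
  rw [uIcc_of_le hT] at h1
  exact h1 ⟨h2.1.le, h2.2⟩ 0 (left_mem_Icc.2 hT)

theorem continuousOn_integral_vol {T : ℝ} (hT : 0 ≤ T) {g : ℝ → ℝ} (hg : Integrable g (vol T)) :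
    ContinuousOn (fun t => ∫ s in (0 : ℝ)..t, g s) (Icc 0 T) := by
  have h := intervalIntegral.continuousOn_primitive_interval' (μ := volume) (a := 0)
    (b₁ := 0) (b₂ := T) ((integrable_vol_iff hT).1 hg) left_mem_uIcc
  rwa [uIcc_of_le hT] at h

/-- The Riemann–Liouville derivative inverts the Riemann–Liouville integral. -/
theorem rlDeriv_ae_eq {T α : ℝ} (hT : 0 < T) (hα : 0 < α) (hα1 : α ≤ 1) {u g : ℝ → ℝ}
    (hg : Integrable g (vol T)) (hu : u =ᵐ[vol T] rlIntegral α g) :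
    rlDeriv α u =ᵐ[vol T] g := by
  rcases hα1.lt_or_eq with h1 | rfl
  -- Here $I^{1-\alpha}u = I^{1-\alpha}I^\alpha g = \int_0^t g$ at every point, since the integral
  -- sees only the a.e. class of `u`; Lebesgue differentiation finishes.
  · have hfl : ⌊α⌋₊ = 0 := Nat.floor_eq_zero.2 h1
    filter_upwards [ae_vol_hasDerivAt hT.le hg, ae_vol_mem_Ioo T] with t hd ht
    rw [rlDeriv, hfl, zero_add, iteratedDeriv_one, Nat.cast_one]
    refine (hd.congr_of_eventuallyEq ?_).deriv
    filter_upwards [Ioo_mem_nhds ht.1 ht.2] with s hs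
    have hs' : s ∈ Icc 0 T := ⟨hs.1.le, hs.2.le⟩
    rw [rlIntegral_congr hs' hu, rlIntegral_rlIntegral (by linarith) hα (by ring) hs' hg]
  -- At $\alpha = 1$ the definition takes two derivatives of $I^1u$. The first gives the continuous
  -- representative $\int_0^s g$ throughout $(0,T)$, the second gives `g` a.e.
  · have hfl : ⌊(1 : ℝ)⌋₊ = 1 := Nat.floor_one
    have hc := continuousOn_integral_vol hT.le hg
    have key : ∀ s ∈ Ioo 0 T, deriv (rlIntegral 1 u) s = ∫ r in (0 : ℝ)..s, g r := by
      intro s hs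
      have h2 : HasDerivAt (fun t => ∫ s in (0 : ℝ)..t, ∫ r in (0 : ℝ)..s, g r)
          (∫ r in (0 : ℝ)..s, g r) s := by
        have hnhds : Icc 0 T ∈ 𝓝 s := Icc_mem_nhds hs.1 hs.2
        refine intervalIntegral.integral_hasDerivAt_right ?_ ?_ (hc.continuousAt hnhds)
        · refine ContinuousOn.intervalIntegrable (hc.mono ?_)
          rw [uIcc_of_le hs.1.le]
          exact Icc_subset_Icc_right hs.2.le
        · exact (hc.mono Ioo_subset_Icc_self).stronglyMeasurableAtFilter isOpen_Ioo s hs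
      refine (h2.congr_of_eventuallyEq ?_).deriv
      filter_upwards [Ioo_mem_nhds hs.1 hs.2] with t ht
      rw [rlIntegral_congr ⟨ht.1.le, ht.2.le⟩ hu, rlIntegral_one]
      simp only [rlIntegral_one]
    filter_upwards [ae_vol_hasDerivAt hT.le hg, ae_vol_mem_Ioo T] with t hd ht
    rw [rlDeriv, hfl]
    norm_num
    rw [iteratedDeriv_succ, iteratedDeriv_one]
    refine (hd.congr_of_eventuallyEq ?_).deriv
    filter_upwards [Ioo_mem_nhds ht.1 ht.2] with s hs
    exact key s hs

end Beta

end FracKirchhoff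

/-! ### Hölder estimates and compactness of the Riemann–Liouville integral. -/

namespace FracKirchhoff

section Hoelder

variable {θ T s t : ℝ}

theorem intervalIntegrable_sub_rpow (hθ : 0 < θ) :
    IntervalIntegrable (fun r => (t - r) ^ (θ - 1)) volume s t := by
  have h := (intervalIntegral.intervalIntegrable_rpow' (a := t - s) (b := 0)
    (show -1 < θ - 1 by linarith)).comp_sub_left t
  simpa using h

theorem integral_sub_rpow (hθ : 0 < θ) :
    ∫ r in s..t, (t - r) ^ (θ - 1) = (t - s) ^ θ / θ := by
  rw [intervalIntegral.integral_comp_sub_left (fun x => x ^ (θ - 1)) t, sub_self,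
    integral_rpow (Or.inl (by linarith)), sub_add_cancel, Real.zero_rpow hθ.ne', sub_zero]

theorem Ioc_inter_Ico_ae_eq (hs : 0 ≤ s) (ht : t ≤ T) :
    (Ioc 0 T ∩ Ico s t : Set ℝ) =ᵐ[volume] Ioc s t := by
  have h : (Ico s t : Set ℝ) =ᵐ[volume] Ioc s t := Ico_ae_eq_Ioc
  have h2 : (Ioc 0 T ∩ Ico s t : Set ℝ) =ᵐ[volume] (Ioc 0 T ∩ Ioc s t : Set ℝ) :=
    (ae_eq_refl _).inter h
  rwa [inter_eq_self_of_subset_right (Ioc_subset_Ioc hs ht)] at h2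

theorem integrable_vol_indicator_rpow (hθ : 0 < θ) (hs : 0 ≤ s) (hst : s ≤ t) (ht : t ≤ T) :
    Integrable ((Ico s t).indicator fun r => (t - r) ^ (θ - 1)) (vol T) := by
  rw [integrable_indicator_iff measurableSet_Ico, IntegrableOn, vol,
    Measure.restrict_restrict measurableSet_Ico, inter_comm,
    Measure.restrict_congr_set (Ioc_inter_Ico_ae_eq hs ht)]
  exact (intervalIntegrable_iff_integrableOn_Ioc_of_le hst).1 (intervalIntegrable_sub_rpow hθ)

theorem integral_vol_indicator_rpow (hθ : 0 < θ) (hs : 0 ≤ s) (hst : s ≤ t) (ht : t ≤ T) :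
    ∫ r, (Ico s t).indicator (fun r => (t - r) ^ (θ - 1)) r ∂(vol T) = (t - s) ^ θ / θ := by
  rw [vol, setIntegral_indicator measurableSet_Ico,
    setIntegral_congr_set (Ioc_inter_Ico_ae_eq hs ht),
    ← intervalIntegral.integral_of_le hst, integral_sub_rpow hθ]

theorem sub_rpow_le {q A B : ℝ} (hq : 1 ≤ q) (hB : 0 ≤ B) (hAB : B ≤ A) :
    (A - B) ^ q ≤ A ^ q - B ^ q := by
  have := Real.add_rpow_le_rpow_add (sub_nonneg.2 hAB) hB hq
  rw [sub_add_cancel] at this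
  linarith

/-- Pointwise bound for increments of the Riemann–Liouville kernel. -/
theorem abs_rlKernel_sub_rpow_le {α q : ℝ} (hα : 0 < α) (hα1 : α ≤ 1) (hq : 1 ≤ q)
    (hst : s ≤ t) {r : ℝ} (hr : 0 ≤ r) :
    |rlKernel α (t - r) - rlKernel α (s - r)| ^ q ≤ (1 / Real.Gamma α) ^ q *
      ((Ico 0 s).indicator (fun r => (s - r) ^ ((α - 1) * q)) r -
        (Ico 0 t).indicator (fun r => (t - r) ^ ((α - 1) * q)) r +
        2 * (Ico s t).indicator (fun r => (t - r) ^ ((α - 1) * q)) r) := by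
  have hΓ := Real.Gamma_pos_of_pos hα
  have hq0 : 0 < q := by linarith
  have pw : ∀ x : ℝ, 0 ≤ x → x ^ ((α - 1) * q) = (x ^ (α - 1)) ^ q := fun x hx =>
    Real.rpow_mul hx _ _
  rcases lt_or_ge r s with h | h
  · have hrt : r < t := h.trans_le hst
    have h1 : 0 < s - r := sub_pos.2 h
    have h2 : 0 < t - r := sub_pos.2 hrt
    have hle : (t - r) ^ (α - 1) ≤ (s - r) ^ (α - 1) :=
      Real.rpow_le_rpow_of_nonpos h1 (by linarith) (by linarith)
    have hB : 0 ≤ (t - r) ^ (α - 1) := Real.rpow_nonneg h2.le _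
    rw [indicator_of_mem (show r ∈ Ico 0 s from ⟨hr, h⟩),
      indicator_of_mem (show r ∈ Ico 0 t from ⟨hr, hrt⟩),
      indicator_of_notMem (fun hh : r ∈ Ico s t => absurd hh.1 (not_le.2 h)), rlKernel, rlKernel,
      if_pos h1, if_pos h2, ← sub_div, abs_div, abs_of_pos hΓ, abs_sub_comm,
      abs_of_nonneg (sub_nonneg.2 hle), div_eq_mul_one_div,
      Real.mul_rpow (sub_nonneg.2 hle) (by positivity), mul_comm, pw _ h1.le, pw _ h2.le]
    refine mul_le_mul_of_nonneg_left ?_ (by positivity)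
    linarith [sub_rpow_le hq hB hle]
  · rw [rlKernel_of_nonpos (sub_nonpos.2 h), sub_zero,
      indicator_of_notMem (fun hh : r ∈ Ico 0 s => absurd hh.2 (not_lt.2 h))]
    rcases lt_or_ge r t with h' | h'
    · have h2 : 0 < t - r := sub_pos.2 h'
      have hB : 0 ≤ (t - r) ^ (α - 1) := Real.rpow_nonneg h2.le _
      rw [indicator_of_mem (show r ∈ Ico 0 t from ⟨hr, h'⟩),
        -- On $[s,t)$ the coefficient $2$ offsets the subtracted indicator of $[0,t)$, and the bound
        -- is an equality.
        indicator_of_mem (show r ∈ Ico s t from ⟨h, h'⟩), rlKernel, if_pos h2, abs_div,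
        abs_of_pos hΓ, abs_of_nonneg hB, div_eq_mul_one_div, Real.mul_rpow hB (by positivity),
        mul_comm, pw _ h2.le]
      exact le_of_eq (by ring)
    · rw [rlKernel_of_nonpos (sub_nonpos.2 h'),
        indicator_of_notMem (fun hh : r ∈ Ico 0 t => absurd hh.2 (not_lt.2 h')),
        indicator_of_notMem (fun hh : r ∈ Ico s t => absurd hh.2 (not_lt.2 h'))]
      simp [Real.zero_rpow hq0.ne']

theorem measurable_rlKernel_sub (α t : ℝ) : Measurable fun r : ℝ => rlKernel α (t - r) :=
  (measurable_rlKernel α).comp (measurable_const.sub measurable_id)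

/-- With $\theta = (\alpha-1)q + 1$ the pointwise bound integrates, up to the Gamma factor, to
$(s^\theta - t^\theta + 2(t-s)^\theta)/\theta$, and $s^\theta \le t^\theta$. -/
theorem integral_abs_rlKernel_sub_rpow_le {α q : ℝ} (hα : 0 < α) (hα1 : α ≤ 1) (hq : 1 ≤ q)
    (hθ : 0 < (α - 1) * q + 1) (hs : 0 ≤ s) (hst : s ≤ t) (ht : t ≤ T) :
    Integrable (fun r => |rlKernel α (t - r) - rlKernel α (s - r)| ^ q) (vol T) ∧
    ∫ r, |rlKernel α (t - r) - rlKernel α (s - r)| ^ q ∂(vol T) ≤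
      (1 / Real.Gamma α) ^ q * (2 / ((α - 1) * q + 1)) * (t - s) ^ ((α - 1) * q + 1) := by
  set θ := (α - 1) * q + 1 with hθ'
  have e : (α - 1) * q = θ - 1 := by rw [hθ', add_sub_cancel_right]
  have i1 := integrable_vol_indicator_rpow hθ le_rfl hs (hst.trans ht)
  have i2 := integrable_vol_indicator_rpow hθ le_rfl (hs.trans hst) ht
  have i3 := integrable_vol_indicator_rpow hθ hs hst ht
  have i12 : Integrable (fun r => (Ico 0 s).indicator (fun r => (s - r) ^ (θ - 1)) r -
    (Ico 0 t).indicator (fun r => (t - r) ^ (θ - 1)) r) (vol T) := i1.sub i2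
  have i32 := i3.const_mul 2
  have hb : ∀ᵐ r ∂(vol T), |rlKernel α (t - r) - rlKernel α (s - r)| ^ q ≤
      (1 / Real.Gamma α) ^ q *
      ((Ico 0 s).indicator (fun r => (s - r) ^ (θ - 1)) r -
        (Ico 0 t).indicator (fun r => (t - r) ^ (θ - 1)) r +
        2 * (Ico s t).indicator (fun r => (t - r) ^ (θ - 1)) r) := by
    filter_upwards [ae_vol_mem T] with r hr
    rw [← e]
    exact abs_rlKernel_sub_rpow_le hα hα1 hq hst hr.1.le
  have iB : Integrable (fun r => (1 / Real.Gamma α) ^ q *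
      ((Ico 0 s).indicator (fun r => (s - r) ^ (θ - 1)) r -
        (Ico 0 t).indicator (fun r => (t - r) ^ (θ - 1)) r +
        2 * (Ico s t).indicator (fun r => (t - r) ^ (θ - 1)) r)) (vol T) :=
    (i12.add i32).const_mul _
  have hmeas : Measurable fun r => |rlKernel α (t - r) - rlKernel α (s - r)| ^ q :=
    (((measurable_rlKernel_sub α t).sub (measurable_rlKernel_sub α s)).abs).pow_const q
  have hint : Integrable (fun r => |rlKernel α (t - r) - rlKernel α (s - r)| ^ q) (vol T) := by
    refine iB.mono' hmeas.aestronglyMeasurable ?_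
    filter_upwards [hb] with r hr
    rwa [Real.norm_of_nonneg (Real.rpow_nonneg (abs_nonneg _) _)]
  refine ⟨hint, (integral_mono_ae hint iB hb).trans ?_⟩
  rw [integral_const_mul, integral_add i12 i32, integral_const_mul]
  rw [integral_sub i1 i2, integral_vol_indicator_rpow hθ le_rfl hs (hst.trans ht),
    integral_vol_indicator_rpow hθ le_rfl (hs.trans hst) ht, sub_zero, sub_zero,
    integral_vol_indicator_rpow hθ hs hst ht, mul_assoc]
  have hΓ := Real.Gamma_pos_of_pos hα
  refine mul_le_mul_of_nonneg_left ?_ (by positivity)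
  have h1 : s ^ θ / θ ≤ t ^ θ / θ := by
    have := Real.rpow_le_rpow hs hst hθ.le
    gcongr
  have h2 : 2 / θ * (t - s) ^ θ = 2 * ((t - s) ^ θ / θ) := by ring
  linarith

theorem memLp_ofReal_of_integrable {Ω : Type*} [MeasurableSpace Ω] {μ : Measure Ω} {q : ℝ}
    (hq : 0 < q) {g : Ω → ℝ} (hg : AEStronglyMeasurable g μ)
    (h : Integrable (fun r => |g r| ^ q) μ) : MemLp g (ENNReal.ofReal q) μ := by
  rw [← integrable_norm_rpow_iff hg (by simpa using hq) ENNReal.ofReal_ne_top,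
    ENNReal.toReal_ofReal hq.le]
  exact h

end Hoelder

section Embedding

variable {T α p : ℝ}

/-- The Hölder exponent conjugate to `p` fits the kernel of order `α > 1 / p`. -/
theorem kernel_exponent_pos (hp : 1 < p) (hα : 1 / p < α) :
    0 < (α - 1) * Real.conjExponent p + 1 := by
  have h1 := Real.HolderConjugate.conjExponent hp
  have hq := h1.symm.pos
  have h2 := h1.inv_add_inv_eq_one
  have h3 : (Real.conjExponent p)⁻¹ * Real.conjExponent p = 1 := inv_mul_cancel₀ hq.ne'
  rw [one_div] at hα
  nlinarith [mul_lt_mul_of_pos_right hα hq]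

theorem memLp_rlKernel_sub (hp : 1 < p) (hα : α ∈ Ioc (1 / p) 1) {s t : ℝ} (hs : 0 ≤ s)
    (hst : s ≤ t) (ht : t ≤ T) :
    MemLp (fun r => rlKernel α (t - r) - rlKernel α (s - r))
      (ENNReal.ofReal (Real.conjExponent p)) (vol T) := by
  have hpq := Real.HolderConjugate.conjExponent hp
  have hα0 : 0 < α := lt_trans (by positivity) hα.1
  exact memLp_ofReal_of_integrable hpq.symm.pos
    ((measurable_rlKernel_sub α t).sub (measurable_rlKernel_sub α s)).aestronglyMeasurable
    (integral_abs_rlKernel_sub_rpow_le hα0 hα.2 hpq.symm.lt.le (kernel_exponent_pos hp hα.1)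
      hs hst ht).1

theorem integrable_of_memLp (hp : 1 < p) {g : ℝ → ℝ} (hg : MemLp g (ENNReal.ofReal p) (vol T)) :
    Integrable g (vol T) :=
  hg.integrable (by rw [← ENNReal.ofReal_one]; exact ENNReal.ofReal_le_ofReal hp.le)

theorem integrable_rlKernel_mul (hp : 1 < p) (hα : α ∈ Ioc (1 / p) 1) {g : ℝ → ℝ}
    (hg : MemLp g (ENNReal.ofReal p) (vol T)) {t : ℝ} (ht : t ∈ Icc 0 T) :
    Integrable (fun r => rlKernel α (t - r) * g r) (vol T) := by
  have hpq := Real.HolderConjugate.conjExponent hp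
  have : ENNReal.HolderConjugate (ENNReal.ofReal (Real.conjExponent p)) (ENNReal.ofReal p) :=
    hpq.symm.ennrealOfReal
  -- At $s = 0$ the second kernel vanishes on $(0,T]$, so the increment is the kernel itself.
  have h := memLp_rlKernel_sub hp hα le_rfl ht.1 ht.2
  refine (h.integrable_mul hg).congr ?_
  filter_upwards [ae_vol_mem T] with r hr
  rw [Pi.mul_apply, rlKernel_of_nonpos (show 0 - r ≤ 0 by linarith [hr.1]), sub_zero]

/-- The constant in the Hölder estimate for the Riemann–Liouville integral on `L^p`. -/
noncomputable def hoelderConst (α p : ℝ) : ℝ :=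
  ((1 / Real.Gamma α) ^ Real.conjExponent p * (2 / ((α - 1) * Real.conjExponent p + 1))) ^
    (1 / Real.conjExponent p)

/-- The Hölder exponent of Riemann–Liouville integrals of `L^p` functions. -/
noncomputable def hoelderExp (α p : ℝ) : ℝ :=
  ((α - 1) * Real.conjExponent p + 1) * (1 / Real.conjExponent p)

theorem hoelderConst_nonneg (hp : 1 < p) (hα : α ∈ Ioc (1 / p) 1) : 0 ≤ hoelderConst α p := by
  have hα0 : 0 < α := lt_trans (by positivity) hα.1
  have hΓ := Real.Gamma_pos_of_pos hα0
  have := kernel_exponent_pos hp hα.1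
  unfold hoelderConst
  positivity

theorem hoelderExp_pos (hp : 1 < p) (hα : α ∈ Ioc (1 / p) 1) : 0 < hoelderExp α p :=
  mul_pos (kernel_exponent_pos hp hα.1)
    (one_div_pos.2 (Real.HolderConjugate.conjExponent hp).symm.pos)

/-- Hölder's inequality applied to the kernel increment and `g`; the resulting exponent equals
$\alpha - 1/p$. -/
theorem abs_rlIntegral_sub_le (hp : 1 < p) (hα : α ∈ Ioc (1 / p) 1) {g : ℝ → ℝ}
    (hg : MemLp g (ENNReal.ofReal p) (vol T)) {s t : ℝ} (hs : 0 ≤ s) (hst : s ≤ t) (ht : t ≤ T) :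
    |rlIntegral α g t - rlIntegral α g s| ≤
      hoelderConst α p * (t - s) ^ hoelderExp α p * (∫ r, |g r| ^ p ∂(vol T)) ^ (1 / p) := by
  have hpq := Real.HolderConjugate.conjExponent hp
  have hα0 : 0 < α := lt_trans (by positivity) hα.1
  have hθ := kernel_exponent_pos hp hα.1
  have hs' : s ∈ Icc 0 T := ⟨hs, hst.trans ht⟩
  have ht' : t ∈ Icc 0 T := ⟨hs.trans hst, ht⟩
  have hΓ := Real.Gamma_pos_of_pos hα0
  set q := Real.conjExponent p with hq
  have hq0 : 0 < q := hpq.symm.pos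
  have hk := integral_abs_rlKernel_sub_rpow_le hα0 hα.2 hpq.symm.lt.le hθ hs hst ht
  rw [rlIntegral_eq ht', rlIntegral_eq hs', ← integral_sub (integrable_rlKernel_mul hp hα hg ht')
    (integrable_rlKernel_mul hp hα hg hs')]
  calc |∫ r, (rlKernel α (t - r) * g r - rlKernel α (s - r) * g r) ∂(vol T)|
      ≤ ∫ r, ‖rlKernel α (t - r) * g r - rlKernel α (s - r) * g r‖ ∂(vol T) :=
        norm_integral_le_integral_norm fun r => rlKernel α (t - r) * g r - rlKernel α (s - r) * g r
    _ = ∫ r, ‖rlKernel α (t - r) - rlKernel α (s - r)‖ * ‖g r‖ ∂(vol T) := by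
        simp only [← sub_mul, norm_mul]
    _ ≤ (∫ r, ‖rlKernel α (t - r) - rlKernel α (s - r)‖ ^ q ∂(vol T)) ^ (1 / q) *
          (∫ r, ‖g r‖ ^ p ∂(vol T)) ^ (1 / p) :=
        integral_mul_norm_le_Lp_mul_Lq hpq.symm (memLp_rlKernel_sub hp hα hs hst ht) hg
    _ ≤ hoelderConst α p * (t - s) ^ hoelderExp α p *
          (∫ r, |g r| ^ p ∂(vol T)) ^ (1 / p) := by
        refine mul_le_mul_of_nonneg_right ?_ (Real.rpow_nonneg
          (integral_nonneg fun r => Real.rpow_nonneg (abs_nonneg _) _) _)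
        have hts := sub_nonneg.2 hst
        rw [hoelderConst, hoelderExp, Real.rpow_mul hts, ← hq,
          ← Real.mul_rpow (by positivity) (Real.rpow_nonneg hts _)]
        refine Real.rpow_le_rpow
          (integral_nonneg fun r => Real.rpow_nonneg (norm_nonneg _) _) hk.2 (by positivity)

theorem rlIntegral_zero_right (γ : ℝ) (g : ℝ → ℝ) : rlIntegral γ g 0 = 0 := by
  simp [rlIntegral]

theorem dist_rlIntegral_le [Fact (1 ≤ ENNReal.ofReal p)] (hp : 1 < p) (hα : α ∈ Ioc (1 / p) 1)
    (g : Lp ℝ (ENNReal.ofReal p) (vol T)) {s t : ℝ} (hs : s ∈ Icc 0 T) (ht : t ∈ Icc 0 T) :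
    |rlIntegral α g t - rlIntegral α g s| ≤
      hoelderConst α p * |t - s| ^ hoelderExp α p * ‖g‖ := by
  have hn : (∫ r, |g r| ^ p ∂(vol T)) ^ (1 / p) = ‖g‖ := by
    rw [← Lp.norm_rpow_eq_integral (by linarith), ← Real.rpow_mul (norm_nonneg _),
      mul_one_div_cancel (by linarith), Real.rpow_one]
  rcases le_total s t with h | h
  · rw [abs_of_nonneg (sub_nonneg.2 h), ← hn]
    exact abs_rlIntegral_sub_le hp hα (Lp.memLp g) hs.1 h ht.2
  · rw [abs_sub_comm, abs_sub_comm t, abs_of_nonneg (sub_nonneg.2 h), ← hn]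
    exact abs_rlIntegral_sub_le hp hα (Lp.memLp g) ht.1 h hs.2

theorem continuousOn_rlIntegral [Fact (1 ≤ ENNReal.ofReal p)] (hp : 1 < p) (hα : α ∈ Ioc (1 / p) 1)
    (g : Lp ℝ (ENNReal.ofReal p) (vol T)) : ContinuousOn (rlIntegral α g) (Icc 0 T) := by
  intro s hs
  rw [ContinuousWithinAt, tendsto_iff_dist_tendsto_zero]
  have hc : ContinuousAt (fun t => hoelderConst α p * |t - s| ^ hoelderExp α p * ‖g‖) s := by
    have : ContinuousAt (fun t : ℝ => |t - s| ^ hoelderExp α p) s :=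
      ContinuousAt.rpow_const (by fun_prop) (Or.inr (hoelderExp_pos hp hα).le)
    fun_prop
  have h0 : Tendsto (fun t => hoelderConst α p * |t - s| ^ hoelderExp α p * ‖g‖)
      (𝓝[Icc 0 T] s) (𝓝 0) := by
    have := hc.tendsto
    rw [sub_self, abs_zero, Real.zero_rpow (hoelderExp_pos hp hα).ne', mul_zero, zero_mul] at this
    exact this.mono_left nhdsWithin_le_nhds
  refine squeeze_zero' (Eventually.of_forall fun _ => dist_nonneg) ?_ h0
  filter_upwards [self_mem_nhdsWithin] with t ht
  exact dist_rlIntegral_le hp hα g hs ht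

theorem rlIntegral_add (hp : 1 < p) (hα : α ∈ Ioc (1 / p) 1)
    (g h : Lp ℝ (ENNReal.ofReal p) (vol T)) {t : ℝ} (ht : t ∈ Icc 0 T) :
    rlIntegral α (g + h : Lp ℝ (ENNReal.ofReal p) (vol T)) t =
      rlIntegral α g t + rlIntegral α h t := by
  rw [rlIntegral_congr ht (Lp.coeFn_add g h), rlIntegral_eq ht, rlIntegral_eq ht, rlIntegral_eq ht,
    ← integral_add (integrable_rlKernel_mul hp hα (Lp.memLp g) ht)
      (integrable_rlKernel_mul hp hα (Lp.memLp h) ht)]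
  simp only [Pi.add_apply, mul_add]

theorem rlIntegral_smul (c : ℝ) (g : Lp ℝ (ENNReal.ofReal p) (vol T)) {t : ℝ}
    (ht : t ∈ Icc 0 T) :
    rlIntegral α (c • g : Lp ℝ (ENNReal.ofReal p) (vol T)) t = c * rlIntegral α g t := by
  rw [rlIntegral_congr ht (Lp.coeFn_smul c g), rlIntegral_eq ht, rlIntegral_eq ht,
    ← integral_const_mul]
  simp only [Pi.smul_apply, smul_eq_mul, mul_left_comm]

/-- The Riemann–Liouville integral as a bounded operator from `L^p` to continuous functions. -/
noncomputable def rlOperator (T : ℝ) (hp : 1 < p) [Fact (1 ≤ ENNReal.ofReal p)]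
    (hα : α ∈ Ioc (1 / p) 1) : Lp ℝ (ENNReal.ofReal p) (vol T) →L[ℝ] C(Icc 0 T, ℝ) :=
  LinearMap.mkContinuous
    { toFun := fun g => ⟨fun t => rlIntegral α g t, (continuousOn_rlIntegral hp hα g).domRestrict⟩
      map_add' := fun g h => by
        ext t
        exact rlIntegral_add hp hα g h t.2
      map_smul' := fun c g => by
        ext t
        exact rlIntegral_smul c g t.2 }
    (hoelderConst α p * |T| ^ hoelderExp α p) fun g => by
      have hC := hoelderConst_nonneg hp hα
      refine (ContinuousMap.norm_le _ (by positivity)).2 fun t => ?_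
      have hT : (0 : ℝ) ≤ T := t.2.1.trans t.2.2
      have h := dist_rlIntegral_le hp hα g (left_mem_Icc.2 hT) t.2
      rw [rlIntegral_zero_right, sub_zero, sub_zero] at h
      refine h.trans ?_
      have : |(t : ℝ)| ^ hoelderExp α p ≤ |T| ^ hoelderExp α p :=
        Real.rpow_le_rpow (abs_nonneg _) (abs_le_abs_of_nonneg t.2.1 t.2.2)
          (hoelderExp_pos hp hα).le
      gcongr

/-- The image of the unit ball is uniformly bounded and has a common Hölder modulus, so
Arzelà–Ascoli applies after passing to bounded continuous functions. -/
theorem isCompactOperator_rlOperator (hp : 1 < p) [Fact (1 ≤ ENNReal.ofReal p)]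
    (hα : α ∈ Ioc (1 / p) 1) : IsCompactOperator (rlOperator T hp hα) := by
  set K := rlOperator T hp hα with hK
  suffices h : IsCompact (closure (K '' Metric.closedBall 0 1)) from
    (isCompactOperator_iff_isCompact_closure_image_closedBall
      (K : Lp ℝ (ENNReal.ofReal p) (vol T) →ₗ[ℝ] C(Icc 0 T, ℝ)) one_pos).2 h
  set e := ContinuousMap.isometryEquivBoundedOfCompact (Icc (0 : ℝ) T) ℝ with he
  have hA : IsCompact (closure (e '' (K '' Metric.closedBall 0 1))) := by
    refine BoundedContinuousFunction.arzela_ascoli (Metric.closedBall (0 : ℝ) ‖K‖)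
      (isCompact_closedBall _ _) _ ?_ ?_
    · rintro _ t ⟨_, ⟨g, hg, rfl⟩, rfl⟩
      rw [mem_closedBall_zero_iff] at hg ⊢
      calc ‖K g t‖ ≤ ‖K g‖ := (K g).norm_coe_le_norm t
        _ ≤ ‖K‖ * ‖g‖ := K.le_opNorm g
        _ ≤ ‖K‖ := mul_le_of_le_one_right (norm_nonneg K) hg
    · have hc : Continuous fun x : ℝ => hoelderConst α p * x ^ hoelderExp α p := by
        have : Continuous fun x : ℝ => x ^ hoelderExp α p :=
          continuous_id.rpow_const fun _ => Or.inr (hoelderExp_pos hp hα).le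
        fun_prop
      refine Metric.equicontinuous_of_continuity_modulus
        (fun x => hoelderConst α p * x ^ hoelderExp α p) ?_ _ ?_
      · have := hc.tendsto 0
        rwa [Real.zero_rpow (hoelderExp_pos hp hα).ne', mul_zero] at this
      · rintro s t ⟨_, _, ⟨g, hg, rfl⟩, rfl⟩
        rw [mem_closedBall_zero_iff] at hg
        have h := dist_rlIntegral_le hp hα g t.2 s.2
        refine h.trans (mul_le_of_le_one_right ?_ hg)
        exact mul_nonneg (hoelderConst_nonneg hp hα) (Real.rpow_nonneg (abs_nonneg _) _)
  rw [← e.toHomeomorph.isCompact_image, e.toHomeomorph.image_closure]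
  exact hA

end Embedding

end FracKirchhoff

/-! ### Test functions and the description of $E_0^{\alpha,p}$ by derivatives. -/

namespace FracKirchhoff

section TestFunctions

variable {T α p : ℝ}

theorem abs_rlIntegral_le_of_bound {β M : ℝ} (hβ : 0 < β) {ψ : ℝ → ℝ} (hM : ∀ t, |ψ t| ≤ M)
    {t : ℝ} (ht : t ∈ Icc 0 T) :
    |rlIntegral β ψ t| ≤ M * (1 / Real.Gamma β * (T ^ β / β)) := by
  have hΓ := Real.Gamma_pos_of_pos hβ
  have hM0 : 0 ≤ M := (abs_nonneg _).trans (hM 0)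
  have hi := integrable_vol_indicator_rpow hβ le_rfl ht.1 ht.2
  rw [rlIntegral_eq ht]
  have h1 := norm_integral_le_of_norm_le (f := fun s => rlKernel β (t - s) * ψ s)
    ((hi.const_mul (1 / Real.Gamma β)).const_mul M) (by
      filter_upwards [ae_vol_mem T] with s hs
      rw [norm_mul, Real.norm_of_nonneg (rlKernel_nonneg hβ _), mul_comm]
      refine mul_le_mul (hM s) (le_of_eq ?_) (rlKernel_nonneg hβ _) hM0
      by_cases h : s < t
      · rw [indicator_of_mem (show s ∈ Ico 0 t from ⟨hs.1.le, h⟩), rlKernel, if_pos (sub_pos.2 h)]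
        ring
      · rw [indicator_of_notMem (fun hh : s ∈ Ico 0 t => h hh.2),
          rlKernel_of_nonpos (sub_nonpos.2 (not_lt.1 h)), mul_zero])
  rw [integral_const_mul, integral_const_mul, integral_vol_indicator_rpow hβ le_rfl ht.1 ht.2,
    sub_zero] at h1
  refine h1.trans ?_
  have := Real.rpow_le_rpow ht.1 ht.2 hβ.le
  gcongr

theorem memLp_rlIntegral_of_bound {β M : ℝ} (hβ : 0 < β) {ψ : ℝ → ℝ} (hψ : Measurable ψ)
    (hM : ∀ t, |ψ t| ≤ M) (q : ℝ≥0∞) : MemLp (rlIntegral β ψ) q (vol T) := by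
  refine MemLp.of_bound ?_ (M * (1 / Real.Gamma β * (T ^ β / β))) ?_
  · have hm : Measurable fun z : ℝ × ℝ => rlKernel β (z.1 - z.2) * ψ z.2 :=
      ((measurable_rlKernel β).comp (measurable_fst.sub measurable_snd)).mul
        (hψ.comp measurable_snd)
    refine (hm.stronglyMeasurable.integral_prod_right' (ν := vol T)).aestronglyMeasurable.congr ?_
    filter_upwards [ae_vol_mem T] with t ht
    exact (rlIntegral_eq ⟨ht.1.le, ht.2⟩ ψ).symm
  · filter_upwards [ae_vol_mem T] with t ht
    exact abs_rlIntegral_le_of_bound hβ hM ⟨ht.1.le, ht.2⟩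

theorem IsTest.eq_zero_of_notMem {φ : ℝ → ℝ} (hφ : IsTest T φ) {t : ℝ} (ht : t ∉ Ioo 0 T) :
    φ t = 0 :=
  image_eq_zero_of_notMem_tsupport fun h => ht (hφ.2.2 h)

/-- Every test function is a Riemann–Liouville integral of an `L^p` function. -/
theorem IsTest.exists_rlIntegral_eq (hp : 1 < p) (hα : α ∈ Ioc (1 / p) 1) {φ : ℝ → ℝ}
    (hφ : IsTest T φ) :
    ∃ g : Lp ℝ (ENNReal.ofReal p) (vol T), ∀ t ∈ Icc 0 T, rlIntegral α g t = φ t := by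
  have hα0 : 0 < α := lt_trans (by positivity) hα.1
  have hc : Continuous (deriv φ) := hφ.1.continuous_deriv (by simp)
  obtain ⟨M, hM⟩ := hφ.2.1.deriv.exists_bound_of_continuous hc
  have hφ0 : φ 0 = 0 := hφ.eq_zero_of_notMem fun h => lt_irrefl _ h.1
  have hftc : ∀ t, ∫ s in (0 : ℝ)..t, deriv φ s = φ t := fun t => by
    rw [intervalIntegral.integral_deriv_eq_sub
      (fun s _ => (hφ.1.differentiable (by simp)).differentiableAt)
      (hc.intervalIntegrable _ _), hφ0, sub_zero]
  have hbd : MemLp (deriv φ) (ENNReal.ofReal p) (vol T) :=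
    MemLp.of_bound hc.aestronglyMeasurable M (Eventually.of_forall hM)
  rcases hα.2.lt_or_eq with h1 | rfl
  -- The preimage is $I^{1-\alpha}\varphi'$, because $I^\alpha I^{1-\alpha}\varphi' = \int_0^t
  -- \varphi' = \varphi$.
  · have hm : MemLp (rlIntegral (1 - α) (deriv φ)) (ENNReal.ofReal p) (vol T) :=
      memLp_rlIntegral_of_bound (sub_pos.2 h1) hc.measurable hM _
    refine ⟨hm.toLp _, fun t ht => ?_⟩
    rw [rlIntegral_congr ht hm.coeFn_toLp,
      rlIntegral_rlIntegral hα0 (sub_pos.2 h1) (by ring) ht (integrable_of_memLp hp hbd), hftc]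
  · refine ⟨hbd.toLp _, fun t ht => ?_⟩
    rw [rlIntegral_congr ht hbd.coeFn_toLp, rlIntegral_one, hftc]

variable [Fact (1 ≤ ENNReal.ofReal p)]

/-- The Riemann–Liouville derivatives of test functions. -/
noncomputable def testDerivs (T : ℝ) (hp : 1 < p) (hα : α ∈ Ioc (1 / p) 1) :
    Submodule ℝ (Lp ℝ (ENNReal.ofReal p) (vol T)) where
  carrier := {g | ∃ φ, IsTest T φ ∧ ∀ t ∈ Icc 0 T, rlIntegral α g t = φ t}
  zero_mem' := by
    refine ⟨fun _ => 0, ⟨contDiff_const, HasCompactSupport.zero, by simp [tsupport]⟩,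
      fun t ht => ?_⟩
    have := rlIntegral_smul (α := α) 0 (0 : Lp ℝ (ENNReal.ofReal p) (vol T)) ht
    rwa [zero_mul, zero_smul] at this
  add_mem' := by
    rintro g h ⟨φ, hφ, hg⟩ ⟨ψ, hψ, hh⟩
    refine ⟨φ + ψ, ⟨hφ.1.add hψ.1, hφ.2.1.add hψ.2.1,
      (tsupport_add φ ψ).trans (union_subset hφ.2.2 hψ.2.2)⟩, fun t ht => ?_⟩
    rw [rlIntegral_add hp hα g h ht, hg t ht, hh t ht, Pi.add_apply]
  smul_mem' := by
    rintro c g ⟨φ, hφ, hg⟩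
    refine ⟨fun t => c • φ t, ⟨hφ.1.const_smul c, hφ.2.1.smul_left (f := fun _ => c),
      (tsupport_smul_subset_right (fun _ => c) φ).trans hφ.2.2⟩, fun t ht => ?_⟩
    rw [rlIntegral_smul c g ht, hg t ht]
    rfl

/-- The Riemann–Liouville derivatives of the elements of the fractional derivative space. -/
noncomputable def derivSpace (T : ℝ) (hp : 1 < p) (hα : α ∈ Ioc (1 / p) 1) :
    Submodule ℝ (Lp ℝ (ENNReal.ofReal p) (vol T)) :=
  (testDerivs T hp hα).topologicalClosure

/-- Evaluation at $T$ is continuous on $L^p$ through `rlOperator`, so the vanishing boundary value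
passes from test functions to the closure. -/
theorem rlIntegral_right_eq_zero (hT : 0 < T) (hp : 1 < p) (hα : α ∈ Ioc (1 / p) 1)
    {g : Lp ℝ (ENNReal.ofReal p) (vol T)} (hg : g ∈ derivSpace T hp hα) :
    rlIntegral α g T = 0 := by
  have hcl : IsClosed {g | rlOperator T hp hα g ⟨T, right_mem_Icc.2 hT.le⟩ = 0} :=
    isClosed_eq ((continuous_eval_const _).comp (rlOperator T hp hα).continuous) continuous_const
  have hsub : (testDerivs T hp hα : Set (Lp ℝ (ENNReal.ofReal p) (vol T))) ⊆
      {g | rlOperator T hp hα g ⟨T, right_mem_Icc.2 hT.le⟩ = 0} := by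
    rintro g ⟨φ, hφ, h⟩
    exact (h T (right_mem_Icc.2 hT.le)).trans (hφ.eq_zero_of_notMem fun h => lt_irrefl _ h.2)
  exact closure_minimal hsub hcl hg

theorem memLp_rlIntegral (hp : 1 < p) (hα : α ∈ Ioc (1 / p) 1)
    (g : Lp ℝ (ENNReal.ofReal p) (vol T)) :
    MemLp (rlIntegral α g) (ENNReal.ofReal p) (vol T) := by
  refine MemLp.of_bound ?_ ‖rlOperator T hp hα g‖ ?_
  · exact ((continuousOn_rlIntegral hp hα g).mono Ioc_subset_Icc_self).aestronglyMeasurable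
      measurableSet_Ioc
  · filter_upwards [ae_vol_mem T] with t ht
    exact (rlOperator T hp hα g).norm_coe_le_norm ⟨t, ht.1.le, ht.2⟩

theorem tendsto_eLpNorm_rlIntegral (hp : 1 < p) (hα : α ∈ Ioc (1 / p) 1)
    {g : Lp ℝ (ENNReal.ofReal p) (vol T)} {G : ℕ → Lp ℝ (ENNReal.ofReal p) (vol T)}
    (hG : Tendsto G atTop (𝓝 g)) :
    Tendsto (fun n => eLpNorm (fun t => rlIntegral α g t - rlIntegral α (G n) t)
      (ENNReal.ofReal p) (vol T)) atTop (𝓝 0) := by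
  set c := vol T univ ^ (ENNReal.ofReal p).toReal⁻¹ with hc
  have hcfin : c ≠ ⊤ := ENNReal.rpow_ne_top_of_nonneg (by positivity) (measure_ne_top _ _)
  set K := rlOperator T hp hα
  have h1 : Tendsto (fun n => c * ENNReal.ofReal ‖K g - K (G n)‖) atTop (𝓝 0) := by
    have h2 : Tendsto (fun n => ‖K g - K (G n)‖) atTop (𝓝 0) := by
      have := (((K.continuous.tendsto g).comp hG).const_sub (K g)).norm
      simpa using this
    have h3 := ENNReal.Tendsto.const_mul (a := c) (ENNReal.tendsto_ofReal h2) (Or.inr hcfin)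
    simpa using h3
  refine tendsto_of_tendsto_of_tendsto_of_le_of_le tendsto_const_nhds h1 (fun _ => zero_le)
    fun n => ?_
  refine eLpNorm_le_of_ae_bound ?_
  filter_upwards [ae_vol_mem T] with t ht
  exact (K g - K (G n)).norm_coe_le_norm ⟨t, ht.1.le, ht.2⟩

/-- The elements of the fractional derivative space are the Riemann–Liouville integrals of the
elements of `derivSpace`. -/
theorem mem_E0_iff (hT : 0 < T) (hp : 1 < p) (hα : α ∈ Ioc (1 / p) 1) {u : ℝ → ℝ} :
    u ∈ E0 T α p ↔ ∃ g ∈ derivSpace T hp hα, u =ᵐ[vol T] rlIntegral α g := by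
  have hα0 : 0 < α := lt_trans (by positivity) hα.1
  have hp0 : 0 < p := by linarith
  have hderiv : ∀ (g : Lp ℝ (ENNReal.ofReal p) (vol T)) (u : ℝ → ℝ),
      u =ᵐ[vol T] rlIntegral α g → rlDeriv α u =ᵐ[vol T] g := fun g u hu =>
    rlDeriv_ae_eq hT hα0 hα.2 (integrable_of_memLp hp (Lp.memLp g)) hu
  have hae : ∀ {φ : ℝ → ℝ} {g : Lp ℝ (ENNReal.ofReal p) (vol T)},
      (∀ t ∈ Icc 0 T, rlIntegral α g t = φ t) → φ =ᵐ[vol T] rlIntegral α g := fun h => by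
    filter_upwards [ae_vol_mem T] with t ht
    exact (h t ⟨ht.1.le, ht.2⟩).symm
  constructor
  · rintro ⟨hu, hdu, happ⟩
    have hpos : ∀ n : ℕ, (0 : ℝ≥0∞) < ((n : ℝ≥0∞) + 1)⁻¹ := fun n =>
      ENNReal.inv_pos.2 (by finiteness)
    choose φ hφ hdist using fun n : ℕ => happ _ (hpos n)
    choose G hG using fun n => (hφ n).exists_rlIntegral_eq hp hα
    set g := hdu.toLp with hg
    have hlim : Tendsto (fun n : ℕ => ((n : ℝ≥0∞) + 1)⁻¹) atTop (𝓝 0) := by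
      have := ENNReal.tendsto_inv_nat_nhds_zero.comp (tendsto_add_atTop_nat 1)
      simpa [Function.comp_def] using this
    have hle : ∀ {A B : ℝ≥0∞}, A ≤ (A ^ p + B ^ p) ^ (1 / p) ∧ B ≤ (A ^ p + B ^ p) ^ (1 / p) :=
      fun {A B} => by
        rw [one_div, ENNReal.le_rpow_inv_iff hp0, ENNReal.le_rpow_inv_iff hp0]
        exact ⟨le_self_add, le_add_self⟩
    have hA : Tendsto (fun n => eLpNorm (fun t => u t - φ n t) (ENNReal.ofReal p) (vol T)) atTop
        (𝓝 0) :=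
      tendsto_of_tendsto_of_tendsto_of_le_of_le tendsto_const_nhds hlim (fun _ => zero_le)
        fun n => hle.1.trans (hdist n).le
    have hB : Tendsto (fun n => eLpNorm (fun t => rlDeriv α u t - rlDeriv α (φ n) t)
        (ENNReal.ofReal p) (vol T)) atTop (𝓝 0) :=
      tendsto_of_tendsto_of_tendsto_of_le_of_le tendsto_const_nhds hlim (fun _ => zero_le)
        fun n => hle.2.trans (hdist n).le
    -- The derivatives of the test functions are a.e. the `G n`, so the derivative part of the
    -- distance is the $L^p$ distance from `G n` to `g`.
    have hGg : Tendsto G atTop (𝓝 g) := by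
      rw [Lp.tendsto_Lp_iff_tendsto_eLpNorm']
      refine hB.congr fun n => ?_
      rw [eLpNorm_sub_comm]
      refine eLpNorm_congr_ae ?_
      filter_upwards [hderiv (G n) (φ n) (hae (hG n)), hdu.coeFn_toLp] with t h1 h2
      rw [Pi.sub_apply, h1, h2]
    refine ⟨g, mem_closure_of_tendsto hGg (Eventually.of_forall fun n => ⟨φ n, hφ n, hG n⟩), ?_⟩
    have hK := tendsto_eLpNorm_rlIntegral hp hα hGg
    have hm := memLp_rlIntegral hp hα g
    -- The test functions converge in $L^p$ both to `u` and, by continuity of $I^\alpha$, to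
    -- $I^\alpha g$.
    have hzero : eLpNorm (fun t => u t - rlIntegral α g t) (ENNReal.ofReal p) (vol T) = 0 := by
      have hsum := hA.add hK
      rw [add_zero] at hsum
      refine le_antisymm (ge_of_tendsto' hsum fun n => ?_) zero_le
      have hφm : AEStronglyMeasurable (φ n) (vol T) := (hφ n).1.continuous.aestronglyMeasurable
      have h1 := eLpNorm_sub_le (μ := vol T) (p := ENNReal.ofReal p)
        (f := fun t => u t - φ n t) (g := fun t => rlIntegral α g t - rlIntegral α (G n) t)
        (hu.1.sub hφm) (hm.1.sub (memLp_rlIntegral hp hα (G n)).1) Fact.out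
      refine le_trans (le_of_eq (eLpNorm_congr_ae ?_)) h1
      filter_upwards [hae (hG n)] with t ht
      simp only [Pi.sub_apply, ht]
      ring
    have hzero' := (eLpNorm_eq_zero_iff (hu.1.sub hm.1) (by simpa using hp0)).1 hzero
    filter_upwards [hzero'] with t ht
    exact sub_eq_zero.1 ht
  · rintro ⟨g, hg, hu⟩
    have hdu := hderiv g u hu
    refine ⟨(memLp_rlIntegral hp hα g).ae_eq hu.symm, (Lp.memLp g).ae_eq hdu.symm, fun ε hε => ?_⟩
    obtain ⟨G, hG, hGg⟩ := mem_closure_iff_seq_limit.1 hg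
    choose φ hφ hGφ using hG
    have hA : Tendsto (fun n => eLpNorm (fun t => u t - φ n t) (ENNReal.ofReal p) (vol T)) atTop
        (𝓝 0) := by
      refine (tendsto_eLpNorm_rlIntegral hp hα hGg).congr fun n => eLpNorm_congr_ae ?_
      filter_upwards [hu, hae (hGφ n)] with t h1 h2
      rw [h1, h2]
    have hB : Tendsto (fun n => eLpNorm (fun t => rlDeriv α u t - rlDeriv α (φ n) t)
        (ENNReal.ofReal p) (vol T)) atTop (𝓝 0) := by
      refine ((Lp.tendsto_Lp_iff_tendsto_eLpNorm' _ _).1 hGg).congr fun n => ?_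
      rw [eLpNorm_sub_comm]
      refine eLpNorm_congr_ae ?_
      filter_upwards [hderiv (G n) (φ n) (hae (hGφ n)), hdu] with t h1 h2
      rw [Pi.sub_apply, h1, h2]
    have hlim := ((hA.ennrpow_const p).add (hB.ennrpow_const p)).ennrpow_const (1 / p)
    rw [ENNReal.zero_rpow_of_pos hp0, add_zero, ENNReal.zero_rpow_of_pos (by positivity)] at hlim
    obtain ⟨n, hn⟩ := (hlim.eventually (gt_mem_nhds hε)).exists
    exact ⟨φ n, hφ n, hn⟩

theorem exists_isTest_ne_zero (hT : 0 < T) : ∃ φ, IsTest T φ ∧ φ (T / 2) ≠ 0 := by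
  obtain ⟨φ, h1, h2, h3, -, h4⟩ := exists_contDiff_tsupport_subset (n := ⊤)
    (Ioo_mem_nhds (half_pos hT) (half_lt_self hT))
  exact ⟨φ, ⟨h3, h2, h1⟩, by simp [h4]⟩

theorem nontrivial_derivSpace (hT : 0 < T) (hp : 1 < p) (hα : α ∈ Ioc (1 / p) 1) :
    Nontrivial (derivSpace T hp hα) := by
  obtain ⟨φ, hφ, hne⟩ := exists_isTest_ne_zero hT
  obtain ⟨g, hg⟩ := hφ.exists_rlIntegral_eq hp hα
  have hmem : g ∈ testDerivs T hp hα := ⟨φ, hφ, hg⟩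
  refine ⟨⟨⟨g, Submodule.le_topologicalClosure _ hmem⟩, 0, fun h => hne ?_⟩⟩
  have h0 : g = 0 := congrArg Subtype.val h
  have ht : T / 2 ∈ Icc 0 T := ⟨by linarith, by linarith⟩
  rw [← hg _ ht]
  have := rlIntegral_smul (α := α) 0 g ht
  rwa [zero_mul, zero_smul, ← h0] at this

end TestFunctions

end FracKirchhoff

/-! ### The fractional problem as an instance of the abstract functional. -/

namespace FracKirchhoff

section Realization

variable {T a b p α : ℝ} {f : ℝ → ℝ → ℝ}

/-- Lebesgue measure on the compact interval `[0, T]`. -/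
noncomputable def volIcc (T : ℝ) : Measure (Icc 0 T) := Measure.comap Subtype.val volume

instance (T : ℝ) : IsFiniteMeasure (volIcc T) := by
  refine ⟨?_⟩
  rw [volIcc, comap_subtype_coe_apply measurableSet_Icc, image_univ, Subtype.range_coe]
  exact measure_Icc_lt_top

theorem integral_volIcc (hT : 0 < T) (h : ℝ → ℝ) :
    ∫ w, h w ∂(volIcc T) = ∫ t in (0 : ℝ)..T, h t := by
  rw [volIcc, integral_subtype_comap measurableSet_Icc, integral_Icc_eq_integral_Ioc,
    intervalIntegral.integral_of_le hT.le]

theorem integral_vol (hT : 0 < T) (h : ℝ → ℝ) :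
    ∫ t, h t ∂(vol T) = ∫ t in (0 : ℝ)..T, h t :=
  (intervalIntegral.integral_of_le hT.le).symm

/-- The zero function would have both `g` and $0$ as fractional derivative. -/
theorem eq_zero_of_rlIntegral_ae_eq_zero (hT : 0 < T) (hp : 1 < p) (hα : α ∈ Ioc (1 / p) 1)
    {g : Lp ℝ (ENNReal.ofReal p) (vol T)} (h : rlIntegral α g =ᵐ[vol T] fun _ => 0) : g = 0 := by
  have hα0 : 0 < α := lt_trans (by positivity) hα.1
  have h1 := rlDeriv_ae_eq hT hα0 hα.2 (integrable_of_memLp hp (Lp.memLp g)) h.symm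
  have h2 : rlDeriv α (fun _ => 0) =ᵐ[vol T] fun _ => 0 :=
    rlDeriv_ae_eq hT hα0 hα.2 (integrable_zero _ _ _)
      (Eventually.of_forall fun t => by simp [rlIntegral])
  exact (Lp.eq_zero_iff_ae_eq_zero).2 (h1.symm.trans h2)

theorem rlDeriv_ae_eq_of_Lp (hT : 0 < T) (hp : 1 < p) (hα : α ∈ Ioc (1 / p) 1) {u : ℝ → ℝ}
    {g : Lp ℝ (ENNReal.ofReal p) (vol T)} (hu : u =ᵐ[vol T] rlIntegral α g) :
    rlDeriv α u =ᵐ[vol T] g :=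
  rlDeriv_ae_eq hT (lt_trans (by positivity) hα.1) hα.2
    (integrable_of_memLp hp (Lp.memLp g)) hu

theorem dEnergy_eq (hT : 0 < T) (hp : 1 < p) (hα : α ∈ Ioc (1 / p) 1) {u : ℝ → ℝ}
    {g : Lp ℝ (ENNReal.ofReal p) (vol T)} (hu : u =ᵐ[vol T] rlIntegral α g) :
    dEnergy T α p u = ‖g‖ ^ p := by
  rw [dEnergy, ← integral_vol hT fun t => |rlDeriv α u t| ^ p,
    Lp.norm_rpow_eq_integral (by linarith)]
  refine integral_congr_ae ?_
  filter_upwards [rlDeriv_ae_eq_of_Lp hT hp hα hu] with t ht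
  rw [ht]

theorem nontriv_iff (hT : 0 < T) (hp : 1 < p) (hα : α ∈ Ioc (1 / p) 1) {u : ℝ → ℝ}
    {g : Lp ℝ (ENNReal.ofReal p) (vol T)} (hu : u =ᵐ[vol T] rlIntegral α g) :
    Nontriv T u ↔ g ≠ 0 := by
  refine not_congr ⟨fun h => eq_zero_of_rlIntegral_ae_eq_zero hT hp hα (hu.symm.trans h), ?_⟩
  rintro rfl
  refine hu.trans ?_
  filter_upwards [ae_vol_mem T] with t ht
  have := rlIntegral_smul (α := α) 0 (0 : Lp ℝ (ENNReal.ofReal p) (vol T)) ⟨ht.1.le, ht.2⟩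
  rwa [zero_mul, zero_smul] at this

variable [Fact (1 ≤ ENNReal.ofReal p)]

/-- The abstract functional that represents the fractional Kirchhoff problem. -/
noncomputable def kirchhoffData (hT : 0 < T) (ha : 0 < a) (hb : 0 < b) (hp : 1 < p)
    (hα : α ∈ Ioc (1 / p) 1)
    (hf : ContinuousOn (fun z : ℝ × ℝ => f z.1 z.2) (Icc 0 T ×ˢ univ))
    (H1 : ∀ t ∈ Icc 0 T, StrictMonoOn (fun x : ℝ => f t x / |x| ^ (p ^ 2 - 1)) {0}ᶜ)
    (H2 : ∀ ε : ℝ, 0 < ε → ∃ δ : ℝ, 0 < δ ∧ ∀ t ∈ Icc 0 T, ∀ x : ℝ, 0 < |x| → |x| < δ →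
      |f t x| ≤ ε * |x| ^ (p - 1))
    (H3 : ∃ μ R : ℝ, p ^ 2 < μ ∧ 0 < R ∧ ∀ t ∈ Icc 0 T, ∀ x : ℝ, R ≤ |x| →
      0 < μ * primitive f t x ∧ μ * primitive f t x ≤ x * f t x) :
    KirchhoffData (Icc 0 T) (derivSpace T hp hα) (volIcc T) where
  a := a
  b := b
  p := p
  K := (rlOperator T hp hα).comp (derivSpace T hp hα).subtypeL
  D g := (duality hp (g : Lp ℝ (ENNReal.ofReal p) (vol T))).comp (derivSpace T hp hα).subtype
  f w x := f w x
  a_pos := ha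
  b_pos := hb
  one_lt_p := hp
  compact := (isCompactOperator_rlOperator hp hα).comp_clm _
  injective g hg := by
    have h1 : ∀ᵐ t ∂(volume.restrict (Icc 0 T  )),
        rlIntegral α (g : Lp ℝ (ENNReal.ofReal p) (vol T)) t = 0 :=
      (ae_restrict_iff_subtype measurableSet_Icc).2 hg
    exact Subtype.ext (eq_zero_of_rlIntegral_ae_eq_zero hT hp hα
      (ae_restrict_of_ae_restrict_of_subset Ioc_subset_Icc_self h1))
  D_self g := duality_self hp _
  hasDerivAt_norm g k y := hasDerivAt_norm_rpow_Lp hp _ _ y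
  continuous_D g k l := continuous_duality_comb hp _ _ _
  continuous_f := hf.comp_continuous (f := fun z : Icc 0 T × ℝ => ((z.1 : ℝ), z.2))
    (by fun_prop) fun z => ⟨z.1.2, mem_univ _⟩
  strictMono w := H1 w w.2
  small ε hε := by
    obtain ⟨δ, hδ, h⟩ := H2 ε hε
    exact ⟨δ, hδ, fun w => h w w.2⟩
  superlinear := by
    obtain ⟨μ, R, hμ, hR, h⟩ := H3
    exact ⟨μ, R, hμ, hR, fun w => h w w.2⟩

variable {hT : 0 < T} {ha : 0 < a} {hb : 0 < b} {hp : 1 < p} {hα : α ∈ Ioc (1 / p) 1}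
  {hf : ContinuousOn (fun z : ℝ × ℝ => f z.1 z.2) (Icc 0 T ×ˢ univ)}
  {H1 : ∀ t ∈ Icc 0 T, StrictMonoOn (fun x : ℝ => f t x / |x| ^ (p ^ 2 - 1)) {0}ᶜ}
  {H2 : ∀ ε : ℝ, 0 < ε → ∃ δ : ℝ, 0 < δ ∧ ∀ t ∈ Icc 0 T, ∀ x : ℝ, 0 < |x| → |x| < δ →
    |f t x| ≤ ε * |x| ^ (p - 1)}
  {H3 : ∃ μ R : ℝ, p ^ 2 < μ ∧ 0 < R ∧ ∀ t ∈ Icc 0 T, ∀ x : ℝ, R ≤ |x| →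
    0 < μ * primitive f t x ∧ μ * primitive f t x ≤ x * f t x}

theorem energy_eq {u : ℝ → ℝ} {g : derivSpace T hp hα}
    (hu : u =ᵐ[vol T] rlIntegral α (g : Lp ℝ (ENNReal.ofReal p) (vol T))) :
    energy T α p a b f u = (kirchhoffData hT ha hb hp hα hf H1 H2 H3).E g := by
  have h1 := integral_volIcc hT fun t =>
    primitive f t (rlIntegral α (g : Lp ℝ (ENNReal.ofReal p) (vol T)) t)
  have h2 : ∫ t in (0 : ℝ)..T, primitive f t (u t) = ∫ t in (0 : ℝ)..T,
      primitive f t (rlIntegral α (g : Lp ℝ (ENNReal.ofReal p) (vol T)) t) := by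
    rw [← integral_vol hT fun t => primitive f t (u t), ← integral_vol hT fun t =>
      primitive f t (rlIntegral α (g : Lp ℝ (ENNReal.ofReal p) (vol T)) t)]
    refine integral_congr_ae ?_
    filter_upwards [hu] with t ht
    rw [ht]
  rw [energy, dEnergy_eq hT hp hα hu, h2, ← h1]
  rfl

theorem firstVariation_eq {u v : ℝ → ℝ} {g k : derivSpace T hp hα}
    (hu : u =ᵐ[vol T] rlIntegral α (g : Lp ℝ (ENNReal.ofReal p) (vol T)))
    (hv : v =ᵐ[vol T] rlIntegral α (k : Lp ℝ (ENNReal.ofReal p) (vol T))) :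
    firstVariation T α p a b f u v = (kirchhoffData hT ha hb hp hα hf H1 H2 H3).dE g k := by
  have h1 := integral_volIcc hT fun t =>
    f t (rlIntegral α (g : Lp ℝ (ENNReal.ofReal p) (vol T)) t) *
      rlIntegral α (k : Lp ℝ (ENNReal.ofReal p) (vol T)) t
  have h2 : ∫ t in (0 : ℝ)..T, f t (u t) * v t = ∫ t in (0 : ℝ)..T,
      f t (rlIntegral α (g : Lp ℝ (ENNReal.ofReal p) (vol T)) t) *
        rlIntegral α (k : Lp ℝ (ENNReal.ofReal p) (vol T)) t := by
    rw [← integral_vol hT fun t => f t (u t) * v t, ← integral_vol hT fun t =>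
      f t (rlIntegral α (g : Lp ℝ (ENNReal.ofReal p) (vol T)) t) *
        rlIntegral α (k : Lp ℝ (ENNReal.ofReal p) (vol T)) t]
    refine integral_congr_ae ?_
    filter_upwards [hu, hv] with t ht ht'
    rw [ht, ht']
  have h3 : ∫ t in (0 : ℝ)..T, phi p (rlDeriv α u t) * rlDeriv α v t =
      duality hp (g : Lp ℝ (ENNReal.ofReal p) (vol T)) k := by
    rw [← integral_vol hT fun t => phi p (rlDeriv α u t) * rlDeriv α v t, duality_apply]
    refine integral_congr_ae ?_
    filter_upwards [rlDeriv_ae_eq_of_Lp hT hp hα hu, rlDeriv_ae_eq_of_Lp hT hp hα hv] with t ht ht'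
    rw [ht, ht']
  rw [firstVariation, dEnergy_eq hT hp hα hu, h2, h3, ← h1]
  rfl

end Realization

end FracKirchhoff

/-! ### Existence of the ground state. -/

theorem theorem1p1 (T a b p α : ℝ) (hT : 0 < T) (ha : 0 < a) (hb : 0 < b) (hp : 1 < p)
    (hα : α ∈ Set.Ioc (1 / p) 1) (f : ℝ → ℝ → ℝ)
    (hf : ContDiffOn ℝ 1 (fun z : ℝ × ℝ => f z.1 z.2) (Set.Icc 0 T ×ˢ Set.univ))
    (H1 : ∀ t ∈ Set.Icc 0 T, StrictMonoOn (fun x : ℝ => f t x / |x| ^ (p ^ 2 - 1)) {0}ᶜ)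
    (H2 : ∀ ε : ℝ, 0 < ε → ∃ δ : ℝ, 0 < δ ∧ ∀ t ∈ Set.Icc 0 T, ∀ x : ℝ, 0 < |x| → |x| < δ →
      |f t x| ≤ ε * |x| ^ (p - 1))
    (H3 : ∃ μ R : ℝ, p ^ 2 < μ ∧ 0 < R ∧ ∀ t ∈ Set.Icc 0 T, ∀ x : ℝ, R ≤ |x| →
      0 < μ * FracKirchhoff.primitive f t x ∧ μ * FracKirchhoff.primitive f t x ≤ x * f t x) :
    ∃ u : ℝ → ℝ, FracKirchhoff.IsGroundState T α p a b f u ∧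
      u ∈ FracKirchhoff.nehari T α p a b f ∧
      ∀ w ∈ FracKirchhoff.nehari T α p a b f,
        FracKirchhoff.energy T α p a b f u ≤ FracKirchhoff.energy T α p a b f w := by
  have : Fact (1 ≤ ENNReal.ofReal p) := ⟨by
    rw [← ENNReal.ofReal_one]
    exact ENNReal.ofReal_le_ofReal hp.le⟩
  have : UniformConvexSpace (Lp ℝ (ENNReal.ofReal p) (FracKirchhoff.vol T)) :=
    uniformConvexSpace_Lp hp
  have : UniformConvexSpace (FracKirchhoff.derivSpace T hp hα) := Submodule.uniformConvexSpace _
  have : CompleteSpace (FracKirchhoff.derivSpace T hp hα) :=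
    (Submodule.isClosed_topologicalClosure _).completeSpace_coe
  have : Nontrivial (FracKirchhoff.derivSpace T hp hα) :=
    FracKirchhoff.nontrivial_derivSpace hT hp hα
  let S := FracKirchhoff.kirchhoffData hT ha hb hp hα hf.continuousOn H1 H2 H3
  have hN : ∀ w ∈ FracKirchhoff.nehari T α p a b f, ∃ k ∈ S.N,
      FracKirchhoff.energy T α p a b f w = S.E k := by
    rintro w ⟨hw, hw0, hw1⟩
    obtain ⟨k, hk, hwk⟩ := (FracKirchhoff.mem_E0_iff hT hp hα).1 hw
    refine ⟨⟨k, hk⟩, ⟨fun h => ?_, ?_⟩, FracKirchhoff.energy_eq hwk⟩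
    · exact (FracKirchhoff.nontriv_iff hT hp hα hwk).1 hw0 (congrArg Subtype.val h)
    · exact (FracKirchhoff.firstVariation_eq (k := ⟨k, hk⟩) hwk hwk).symm.trans hw1
  obtain ⟨g, hg, hmin⟩ := S.exists_isMinOn_N
  -- The integral itself is the continuous representative, so continuity and the boundary values
  -- hold pointwise.
  set u := FracKirchhoff.rlIntegral α (g : Lp ℝ (ENNReal.ofReal p) (FracKirchhoff.vol T))
  have hug : u =ᵐ[FracKirchhoff.vol T]
      FracKirchhoff.rlIntegral α (g : Lp ℝ (ENNReal.ofReal p) (FracKirchhoff.vol T)) :=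
    Filter.EventuallyEq.rfl
  have huE : u ∈ FracKirchhoff.E0 T α p := (FracKirchhoff.mem_E0_iff hT hp hα).2 ⟨g, g.2, hug⟩
  have hu0 : FracKirchhoff.Nontriv T u := (FracKirchhoff.nontriv_iff hT hp hα hug).2
    fun h => hg.1 (Subtype.ext h)
  have hle : ∀ w ∈ FracKirchhoff.nehari T α p a b f,
      FracKirchhoff.energy T α p a b f u ≤ FracKirchhoff.energy T α p a b f w := fun w hw => by
    obtain ⟨k, hk, hwk⟩ := hN w hw
    rw [hwk, FracKirchhoff.energy_eq (hT := hT) (ha := ha) (hb := hb) (hf := hf.continuousOn)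
      (H1 := H1) (H2 := H2) (H3 := H3) hug]
    exact hmin k hk
  -- A nontrivial weak solution tested with itself lies on the Nehari manifold, so `hle` also gives
  -- minimality among weak solutions.
  refine ⟨u, ⟨⟨huE, FracKirchhoff.continuousOn_rlIntegral hp hα _,
    FracKirchhoff.rlIntegral_zero_right α _, FracKirchhoff.rlIntegral_right_eq_zero hT hp hα g.2,
    fun v hv => ?_⟩, hu0, fun w hw hw0 => hle w ⟨hw.1, hw0, sub_eq_zero.2 (hw.2.2.2.2 w hw.1)⟩⟩,
    ⟨huE, hu0, ?_⟩, hle⟩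
  · obtain ⟨k, hk, hvk⟩ := (FracKirchhoff.mem_E0_iff hT hp hα).1 hv
    have h := FracKirchhoff.firstVariation_eq (hT := hT) (ha := ha) (hb := hb)
      (hf := hf.continuousOn) (H1 := H1) (H2 := H2) (H3 := H3) (k := ⟨k, hk⟩) hug hvk
    exact sub_eq_zero.1 (h.trans (S.dE_eq_zero_of_isMinOn_N hg hmin _))
  · exact (FracKirchhoff.firstVariation_eq hug hug).trans hg.2
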